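/- **Setting.** Fix a set $\mathbb E$ of atomic events, a silent step $\tau\notin\mathbb E$ and a relation $\le$ on $\mathbb E\cup\{\tau\}$. A linear recursive specification $E$ is a finite set of equations $X=t_X$, one for each recursion variable $X$, where $t_X$ is a finite sum (the empty sum is $0$) of summands of the forms $(a_1\mathbin{\lfloor\!\lfloor}\cdots\mathbin{\lfloor\!\lfloor}a_k)\,Y$ and $a_1\mathbin{\lfloor\!\lfloor}\cdots\mathbin{\lfloor\!\lfloor}a_k$ with $k\ge 1$, $a_1,\dots,a_k\in\mathbb E\cup\{\tau\}$ and $Y$ a recursion variable of $E$; here $\lfloor\!\lfloor$ is left merge. Write $\surd$ for successful termination. Transitions of terms are generated by the following rules, where $r$ is a term or $\surd$: * $a_1\mathbin{\lfloor\!\lfloor}\cdots\mathbin{\lfloor\!\lfloor}a_k\xrightarrow{\{a_1,\dots,a_k\}}\surd$, provided $a_i\le a_j$ for all $i<j$; * $x+y\xrightarrow{L}r$ if $x\xrightarrow{L}r$ or $y\xrightarrow{L}r$; * $x\cdot y\xrightarrow{L}y$ if $x\xrightarrow{L}\surd$, and $x\cdot y\xrightarrow{L}x'\cdot y$ if $x\xrightarrow{L}x'$;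 * for $I\subseteq\mathbb E$, with $\hat L$ the label $L$ in which the elements of $I$ are replaced by $\tau$: $\tau_I(x)\xrightarrow{\hat L}\surd$ if $x\xrightarrow{L}\surd$, and $\tau_I(x)\xrightarrow{\hat L}\tau_I(x')$ if $x\xrightarrow{L}x'$; * $\langle X|E\rangle$ has exactly the transitions of $t_X$ with each variable $Y$ replaced by $\langle Y|E\rangle$. $E$ is guarded if there is no infinite sequence $\langle X|E\rangle\xrightarrow{\tau}\langle X'|E\rangle\xrightarrow{\tau}\langle X''|E\rangle\xrightarrow{\tau}\cdots$. Variables $X,Y$ of $E$ are in the same cluster for $I\subseteq\mathbb E$ if there are sequences of zero or more transitions from $\langle X|E\rangle$ to $\langle Y|E\rangle$ and from $\langle Y|E\rangle$ to $\langle X|E\rangle$, all of whose actions lie in $I\cup\{\tau\}$; clusters are the equivalence classes. An exit of a cluster $C$ is a summand of $t_Z$ for some $Z\in C$ which is either of the form $b_1\mathbin{\lfloor\!\lfloor}\cdots\mathbin{\lfloor\!\lfloor}b_j$, or of the form $(a_1\mathbin{\lfloor\!\lfloor}\cdots\mathbin{\lfloor\!\lfloor}a_k)\,Y$ where some $a_l\notin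 I\cup\{\tau\}$ or $Y\notin C$. **Prime event structures.** A prime event structure is a set of events labelled in $\mathbb E\cup\{\tau\}$ with a partial order $\leq$ (causality) in which every event has finitely many predecessors, an irreflexive symmetric conflict relation that is inherited along causality, and a termination predicate $\downarrow$ on configurations; configurations are the finite, conflict-free, causally closed sets of events. Events labelled $\tau$ are silent; $\hat C$ is the set of non-silent events of $C$. For configurations $C,C'$, $C\xrightarrow{X}C'$ means $X\ne\emptyset$, $C\cap X=\emptyset$, $C'=C\cup X$; it is a step if the events of $X$ are pairwise concurrent (distinct events neither comparable nor in conflict). $C\xrightarrow{\tau^*}C'$ means zero or more transitions by single silent events. A term denotes the prime event structure obtained by unfolding its transitions. Its events are the pairs (run $\rho$, one action occurrence in the label of the last transition of $\rho$), labelled by that action; distinct events on the same run are concurrent; an event on $\rho$ causes every event on a proper extension of $\rho$; events on runs neither of which is a prefix of the other are in conflict. $C\downarrow$ iff $C$ consists of all events on the prefixes of a run ending in $\surd$. **Equivalences.** Below, $\mathcal P,\mathcal Q$ are two prime event structures, and "symmetrically" refers to exchanging them. * A branching pomset bisimulation is a relation $R$ between their configurations such that whenever $(C,D)\in R$: (i)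 if $C\xrightarrow{X}C'$, then either $X$ is silent and $(C',D)\in R$, or $D\xrightarrow{\tau^*}D_0$ with $(C,D_0)\in R$ and $D_0\xrightarrow{X'}D'$ with $\hat X\cong\hat X'$ (isomorphic labelled partial orders) and $(C',D')\in R$; (ii) if $C\downarrow$, then $D\xrightarrow{\tau^*}D_0$ with $(C,D_0)\in R$ and $D_0\downarrow$; and symmetrically. A rooted branching pomset bisimulation is a relation such that whenever $(C,D)$ is in it: if $C\xrightarrow{X}C'$ then $D\xrightarrow{X'}D'$ such that $X$ and $X'$ are isomorphic as labelled partial orders after deletion of their non-minimal silent events and $(C',D')$ lies in some branching pomset bisimulation; symmetrically; and $C\downarrow$ iff $D\downarrow$. $\mathcal P\approx_{rbp}\mathcal Q$ means that $(\emptyset,\emptyset)$ lies in such a relation. $\approx_{rbs}$ is defined in the same way with steps: $X$ is pairwise concurrent, and so is $\hat X'$ in the branching clause and $X'$ in the rooted clause. * The weakly posetal product consists of the triples $(C,f,D)$ of configurations $C,D$ and an isomorphism of labelled partial orders $f:\hat C\to\hat D$. Let $f[a\mapsto b]$ be $f$ extended by $a\mapsto b$ if $a,b$ are not silent, and $f$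 otherwise. A branching hp-bisimulation is a set $R$ of such triples such that whenever $(C,f,D)\in R$: (i) if $C\xrightarrow{a}C'$ (single event), then either $a$ is silent and $(C',f,D)\in R$, or $D\xrightarrow{\tau^*}D_0$ with $(C,f,D_0)\in R$ and $D_0\xrightarrow{b}D'$ with $b$ labelled as $a$ and $(C',f[a\mapsto b],D')\in R$; (ii) if $C\downarrow$, then $D\xrightarrow{\tau^*}D_0$ with $(C,f,D_0)\in R$ and $D_0\downarrow$; and symmetrically. A rooted branching hp-bisimulation is a set of such triples such that whenever $(C,f,D)$ is in it: if $C\xrightarrow{a}C'$ then $D\xrightarrow{b}D'$ with $b$ labelled as $a$ and $(C',f[a\mapsto b],D')$ in some branching hp-bisimulation; symmetrically; and $C\downarrow$ iff $D\downarrow$. $\mathcal P\approx_{rbhp}\mathcal Q$ means that $(\emptyset,\emptyset,\emptyset)$ lies in such a set. * $\mathcal P\approx_{rbhhp}\mathcal Q$ means that $(\emptyset,\emptyset,\emptyset)$ lies in a rooted branching hp-bisimulation which is downward closed (it contains every triple of the weakly posetal product that is componentwise contained in one of its members) and in whose clauses the resulting triples lie in *hereditary* branching hp-bisimulations $T$: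 if $(C,f,D)\in T$, then for every configuration $C'\subseteq C$ there is a configuration $D'\subseteq D$ such that $(C',f\cap(C'\times D'),D')\in T$, and symmetrically. **Theorem (soundness of CFAR).** Let $E$ be a guarded linear recursive specification, $I\subseteq\mathbb E$, and $X$ a variable in a cluster $C$ of $E$ for $I$. Let the exits of $C$ be $(a_{11}\mathbin{\lfloor\!\lfloor}\cdots\mathbin{\lfloor\!\lfloor}a_{1i_1})Y_1,\dots,(a_{m1}\mathbin{\lfloor\!\lfloor}\cdots\mathbin{\lfloor\!\lfloor}a_{mi_m})Y_m$ and $b_{11}\mathbin{\lfloor\!\lfloor}\cdots\mathbin{\lfloor\!\lfloor}b_{1j_1},\dots,b_{n1}\mathbin{\lfloor\!\lfloor}\cdots\mathbin{\lfloor\!\lfloor}b_{nj_n}$, listed in any order. Then $$\tau\cdot\tau_I(\langle X|E\rangle)\;\approx\;\tau\cdot\tau_I\Big(\sum_{p=1}^{m}(a_{p1}\mathbin{\lfloor\!\lfloor}\cdots\mathbin{\lfloor\!\lfloor}a_{pi_p})\cdot\langle Y_p|E\rangle+\sum_{q=1}^{n}b_{q1}\mathbin{\lfloor\!\lfloor}\cdots\mathbin{\lfloor\!\lfloor}b_{qj_q}\Big)$$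 (a sum without summands being $0$) holds for each of $\approx_{rbs}$, $\approx_{rbp}$, $\approx_{rbhp}$ and $\approx_{rbhhp}$. -/

import Mathlib

namespace APTC

universe u v w w'

/-! ## Actions, linear recursive specifications, terms -/

/-- The atomic events `A` together with the silent step `tau`. -/
inductive Act (A : Type u) : Type u where
  | tau : Act A
  | ev : A → Act A

/-- A summand `(a₁ ⌊⌊ ⋯ ⌊⌊ aₖ) Y` (if `target = some Y`) or `a₁ ⌊⌊ ⋯ ⌊⌊ aₖ` (if `target = none`) of a
linear recursive equation; `k ≥ 1`, `a₁ = head`, and `tail = [a₂, …, aₖ]`. -/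
structure Summand (A : Type u) (V : Type v) : Type (max u v) where
  head : Act A
  tail : List (Act A)
  target : Option V

/-- The list `[a₁, …, aₖ]` of the actions of a summand. -/
def Summand.actions {A : Type u} {V : Type v} (s : Summand A V) : List (Act A) := s.head :: s.tail

/-- A linear recursive specification over the recursion variables `V`: every variable is given the
finite list of the summands of the right-hand side of its equation; an empty list stands for `0`. -/
abbrev Spec (A : Type u) (V : Type v) : Type (max u v) := V → List (Summand A V)

/-- Closed terms: deadlock `0`, the left merges `a₁ ⌊⌊ ⋯ ⌊⌊ aₖ` (`k ≥ 1`) of actions (for `k = 1` the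
constants `a` and `τ`), `x · y`, `x + y`, `τ_I(x)` and `⟨X|E⟩` for linear `E`. -/
inductive Term (A : Type u) (V : Type v) : Type (max u v) where
  | zero : Term A V
  | lmerge (a : Act A) (as : List (Act A)) : Term A V
  | seq (x y : Term A V) : Term A V
  | alt (x y : Term A V) : Term A V
  | abs (I : Set A) (x : Term A V) : Term A V
  | solution (E : Spec A V) (X : V) : Term A V

/-- The constant `τ`. -/
def Term.tau {A : Type u} {V : Type v} : Term A V := .lmerge .tau []

/-- Finite sums of terms; the empty sum is `0`. -/
def Term.sum {A : Type u} {V : Type v} : List (Term A V) → Term A V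
  | [] => .zero
  | [x] => x
  | x :: y :: l => .alt x (Term.sum (y :: l))

/-- The term `(a₁ ⌊⌊ ⋯ ⌊⌊ aₖ) · ⟨Y|E⟩` or `a₁ ⌊⌊ ⋯ ⌊⌊ aₖ` given by a summand. -/
def Summand.toTerm {A : Type u} {V : Type v} (E : Spec A V) (s : Summand A V) : Term A V :=
  match s.target with
  | none => .lmerge s.head s.tail
  | some Y => .seq (.lmerge s.head s.tail) (.solution E Y)

/-- The right-hand side `t_X(⟨X₁|E⟩, …, ⟨Xₙ|E⟩)` of the equation for `X`. -/
def Spec.body {A : Type u} {V : Type v} (E : Spec A V) (X : V) : Term A V :=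
  Term.sum ((E X).map (Summand.toTerm E))

/-- Membership in `I ∪ {τ}`. -/
def Hidden {A : Type u} (I : Set A) : Act A → Prop
  | .tau => True
  | .ev a => a ∈ I

open Classical in
/-- The renaming performed by `τ_I`: the events in `I` become `τ`. -/
noncomputable def hide {A : Type u} (I : Set A) : Act A → Act A
  | .tau => .tau
  | .ev a => if a ∈ I then .tau else .ev a

/-! ## Operational semantics -/

/-- The transition rules. `Step le t [a₁, …, aₖ] (some t')` is `t —{a₁, …, aₖ}→ t'`, and
`Step le t [a₁, …, aₖ] none` is `t —{a₁, …, aₖ}→ √`. The relation `le` on actions is the one in the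
side condition of the rules for the left merge. -/
inductive Step {A : Type u} {V : Type v} (le : Act A → Act A → Prop) :
    Term A V → List (Act A) → Option (Term A V) → Prop where
  | lmerge (a : Act A) (as : List (Act A)) (h : (a :: as).Pairwise le) :
      Step le (.lmerge a as) (a :: as) none
  | alt_left {x y : Term A V} {L : List (Act A)} {r : Option (Term A V)} (h : Step le x L r) :
      Step le (.alt x y) L r
  | alt_right {x y : Term A V} {L : List (Act A)} {r : Option (Term A V)} (h : Step le y L r) :
      Step le (.alt x y) L r
  | seq_done {x y : Term A V} {L : List (Act A)} (h : Step le x L none) :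
      Step le (.seq x y) L (some y)
  | seq_step {x y x' : Term A V} {L : List (Act A)} (h : Step le x L (some x')) :
      Step le (.seq x y) L (some (.seq x' y))
  | abs_done {I : Set A} {x : Term A V} {L : List (Act A)} (h : Step le x L none) :
      Step le (.abs I x) (L.map (hide I)) none
  | abs_step {I : Set A} {x x' : Term A V} {L : List (Act A)} (h : Step le x L (some x')) :
      Step le (.abs I x) (L.map (hide I)) (some (.abs I x'))
  | solution {E : Spec A V} {X : V} {L : List (Act A)} {r : Option (Term A V)}
      (h : Step le (E.body X) L r) : Step le (.solution E X) L r

/-- `E` is guarded: there is no infinite sequence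
`⟨X|E⟩ —τ→ ⟨X'|E⟩ —τ→ ⟨X''|E⟩ —τ→ ⋯`. (A linear specification has no transitions with an empty
label, so the analogous demand on `1`-transitions is void.) -/
def Spec.Guarded {A : Type u} {V : Type v} (le : Act A → Act A → Prop) (E : Spec A V) : Prop :=
  ¬ ∃ X : ℕ → V, ∀ n, Step le (.solution E (X n)) [Act.tau] (some (.solution E (X (n + 1))))

/-! ## Clusters and exits -/

/-- A transition all of whose actions lie in `I ∪ {τ}`. -/
def HiddenStep {A : Type u} {V : Type v} (le : Act A → Act A → Prop) (I : Set A)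
    (t t' : Term A V) : Prop :=
  ∃ L : List (Act A), (∀ a ∈ L, Hidden I a) ∧ Step le t L (some t')

/-- `X` and `Y` are in the same cluster of `E` for `I`. -/
def SameCluster {A : Type u} {V : Type v} (le : Act A → Act A → Prop) (E : Spec A V) (I : Set A)
    (X Y : V) : Prop :=
  Relation.ReflTransGen (HiddenStep le I) (.solution E X) (.solution E Y) ∧
  Relation.ReflTransGen (HiddenStep le I) (.solution E Y) (.solution E X)

/-- `C` is a cluster of `E` for `I`. -/
def IsCluster {A : Type u} {V : Type v} (le : Act A → Act A → Prop) (E : Spec A V) (I : Set A)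
    (C : Set V) : Prop :=
  ∃ X, C = {Y | SameCluster le E I X Y}

/-- The summand `s` is an exit for `C`: it occurs in the equation of some variable in `C`, and if it
is `(a₁ ⌊⌊ ⋯ ⌊⌊ aₖ) Y`, then some `aₗ` lies outside `I ∪ {τ}` or `Y ∉ C`. -/
def IsExit {A : Type u} {V : Type v} (E : Spec A V) (I : Set A) (C : Set V)
    (s : Summand A V) : Prop :=
  (∃ Z ∈ C, s ∈ E Z) ∧
  ∀ Y, s.target = some Y → (∃ a ∈ s.actions, ¬ Hidden I a) ∨ Y ∉ C

/-! ## Prime event structures -/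

/-- Labelled prime event structures with silent events (the events labelled `tau`) and a termination
predicate `done` on configurations. -/
structure PES (A : Type u) where
  Event : Type w
  le : Event → Event → Prop
  conflict : Event → Event → Prop
  label : Event → Act A
  done : Set Event → Prop
  le_refl : ∀ e, le e e
  le_trans : ∀ e f g, le e f → le f g → le e g
  le_antisymm : ∀ e f, le e f → le f e → e = f
  finite_causes : ∀ e, {f | le f e}.Finite
  conflict_irrefl : ∀ e, ¬ conflict e e
  conflict_symm : ∀ e f, conflict e f → conflict f e
  conflict_hered : ∀ e f g, conflict e f → le f g → conflict e g

namespace PES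

variable {A : Type u}

/-- Finite configurations: finite, consistent, causally closed sets of events. -/
def Config (P : PES.{u, w} A) (C : Set P.Event) : Prop :=
  C.Finite ∧ (∀ e ∈ C, ∀ f ∈ C, ¬ P.conflict e f) ∧ ∀ e ∈ C, ∀ f, P.le f e → f ∈ C

/-- Silent events. -/
def Silent (P : PES.{u, w} A) (e : P.Event) : Prop := P.label e = Act.tau

/-- `X̂`: the events of `X` that are not silent. -/
def vis (P : PES.{u, w} A) (X : Set P.Event) : Set P.Event := {e ∈ X | ¬ P.Silent e}

/-- The pomset transition `C —X→ C'`. -/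
def Tr (P : PES.{u, w} A) (C X C' : Set P.Event) : Prop :=
  P.Config C ∧ X.Nonempty ∧ Disjoint C X ∧ C' = C ∪ X ∧ P.Config C'

/-- The events in `X` are pairwise concurrent. -/
def Concurrent (P : PES.{u, w} A) (X : Set P.Event) : Prop :=
  ∀ e ∈ X, ∀ f ∈ X, e ≠ f → ¬ P.le e f ∧ ¬ P.le f e ∧ ¬ P.conflict e f

/-- A sequence of zero or more transitions by single silent events. -/
def TauStar (P : PES.{u, w} A) : Set P.Event → Set P.Event → Prop :=
  Relation.ReflTransGen fun C C' => ∃ e, P.Silent e ∧ P.Tr C {e} C'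

/-- Isomorphism of sets of events as labelled partial orders. -/
def PomIso (P : PES.{u, w} A) (Q : PES.{u, w'} A) (X : Set P.Event) (Y : Set Q.Event) : Prop :=
  ∃ φ : X ≃ Y, (∀ e : X, P.label e = Q.label (φ e)) ∧
    ∀ e f : X, P.le e f ↔ Q.le (φ e) (φ f)

/-- The part of `X` which the rooted clauses observe: the visible events and those silent events that
are minimal in `X`. If the events of `X` are pairwise concurrent, this is all of `X`. -/
def rootVis (P : PES.{u, w} A) (X : Set P.Event) : Set P.Event :=
  {e ∈ X | ¬ P.Silent e ∨ ∀ f ∈ X, P.le f e → f = e}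

/-- Which sets `X` count as transition labels: all pomsets, or only steps. -/
inductive Kind where
  | pomset
  | step

/-- `X` is a label of the given kind. -/
def Label (P : PES.{u, w} A) : Kind → Set P.Event → Prop
  | .pomset, _ => True
  | .step, X => P.Concurrent X

/-- Branching pomset (step) bisimulations. The condition on `X'` says `C₂⁰ ⟹X C₂'`: the transition
may contain further silent events, and its visible part is isomorphic to that of `X`. -/
def BranchingBisim (k : Kind) (P : PES.{u, w} A) (Q : PES.{u, w'} A)
    (R : Set P.Event → Set Q.Event → Prop) : Prop :=
  ∀ C D, R C D → P.Config C ∧ Q.Config D ∧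
    (∀ X C', P.Tr C X C' → P.Label k X →
      ((∀ e ∈ X, P.Silent e) ∧ R C' D) ∨
      ∃ D₀ X' D', Q.TauStar D D₀ ∧ R C D₀ ∧ Q.Tr D₀ X' D' ∧ Q.Label k (Q.vis X') ∧
        PomIso P Q (P.vis X) (Q.vis X') ∧ R C' D') ∧
    (∀ X D', Q.Tr D X D' → Q.Label k X →
      ((∀ e ∈ X, Q.Silent e) ∧ R C D') ∨
      ∃ C₀ X' C', P.TauStar C C₀ ∧ R C₀ D ∧ P.Tr C₀ X' C' ∧ P.Label k (P.vis X') ∧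
        PomIso P Q (P.vis X') (Q.vis X) ∧ R C' D') ∧
    (P.done C → ∃ D₀, Q.TauStar D D₀ ∧ R C D₀ ∧ Q.done D₀) ∧
    (Q.done D → ∃ C₀, P.TauStar C C₀ ∧ R C₀ D ∧ P.done C₀)

/-- Configurations related by some branching pomset (step) bisimulation. -/
def Branching (k : Kind) (P : PES.{u, w} A) (Q : PES.{u, w'} A)
    (C : Set P.Event) (D : Set Q.Event) : Prop :=
  ∃ R, BranchingBisim k P Q R ∧ R C D

/-- Rooted branching pomset (step) bisimulations. -/
def RootedBisim (k : Kind) (P : PES.{u, w} A) (Q : PES.{u, w'} A)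
    (R : Set P.Event → Set Q.Event → Prop) : Prop :=
  ∀ C D, R C D → P.Config C ∧ Q.Config D ∧
    (∀ X C', P.Tr C X C' → P.Label k X →
      ∃ X' D', Q.Tr D X' D' ∧ Q.Label k X' ∧ PomIso P Q (P.rootVis X) (Q.rootVis X') ∧
        Branching k P Q C' D') ∧
    (∀ X D', Q.Tr D X D' → Q.Label k X →
      ∃ X' C', P.Tr C X' C' ∧ P.Label k X' ∧ PomIso P Q (P.rootVis X') (Q.rootVis X) ∧
        Branching k P Q C' D') ∧
    (P.done C ↔ Q.done D)

/-- Rooted branching pomset (step) bisimilarity of prime event structures. -/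
def Rooted (k : Kind) (P : PES.{u, w} A) (Q : PES.{u, w'} A) : Prop :=
  ∃ R, RootedBisim k P Q R ∧ R ∅ ∅

/-- `(C, f, D)` is in the weakly posetal product: `f` is (the graph of) an isomorphism of labelled
partial orders from `Ĉ` onto `D̂`. -/
def Posetal (P : PES.{u, w} A) (Q : PES.{u, w'} A)
    (C : Set P.Event) (f : Set (P.Event × Q.Event)) (D : Set Q.Event) : Prop :=
  P.Config C ∧ Q.Config D ∧
  (∀ p ∈ f, p.1 ∈ P.vis C ∧ p.2 ∈ Q.vis D ∧ P.label p.1 = Q.label p.2) ∧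
  (∀ e ∈ P.vis C, ∃ d, (e, d) ∈ f) ∧ (∀ d ∈ Q.vis D, ∃ e, (e, d) ∈ f) ∧
  ∀ p ∈ f, ∀ q ∈ f, P.le p.1 q.1 ↔ Q.le p.2 q.2

/-- `f[a ↦ b]`; silent events are not recorded. -/
def upd (P : PES.{u, w} A) (Q : PES.{u, w'} A) (f : Set (P.Event × Q.Event))
    (a : P.Event) (b : Q.Event) : Set (P.Event × Q.Event) :=
  f ∪ {p | p = (a, b) ∧ ¬ P.Silent a ∧ ¬ Q.Silent b}

/-- Branching history-preserving bisimulations. -/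
def BranchingHP (P : PES.{u, w} A) (Q : PES.{u, w'} A)
    (R : Set P.Event → Set (P.Event × Q.Event) → Set Q.Event → Prop) : Prop :=
  ∀ C f D, R C f D → Posetal P Q C f D ∧
    (∀ a C', P.Tr C {a} C' →
      (P.Silent a ∧ R C' f D) ∨
      ∃ D₀ b D', Q.TauStar D D₀ ∧ R C f D₀ ∧ Q.Tr D₀ {b} D' ∧ P.label a = Q.label b ∧
        R C' (upd P Q f a b) D') ∧
    (∀ b D', Q.Tr D {b} D' →
      (Q.Silent b ∧ R C f D') ∨
      ∃ C₀ a C', P.TauStar C C₀ ∧ R C₀ f D ∧ P.Tr C₀ {a} C' ∧ P.label a = Q.label b ∧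
        R C' (upd P Q f a b) D') ∧
    (P.done C → ∃ D₀, Q.TauStar D D₀ ∧ R C f D₀ ∧ Q.done D₀) ∧
    (Q.done D → ∃ C₀, P.TauStar C C₀ ∧ R C₀ f D ∧ P.done C₀)

/-- Downward closure with respect to the pointwise order of triples. -/
def DownwardClosed (P : PES.{u, w} A) (Q : PES.{u, w'} A)
    (R : Set P.Event → Set (P.Event × Q.Event) → Set Q.Event → Prop) : Prop :=
  ∀ C f D C' f' D', Posetal P Q C f D → C ⊆ C' → f ⊆ f' → D ⊆ D' → R C' f' D' → R C f D

/-- Downward closure up to silent events: going back on one side can be followed by going back on the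
other side. If there are no silent events, this is `DownwardClosed` for relations inside the posetal
product. -/
def Hereditary (P : PES.{u, w} A) (Q : PES.{u, w'} A)
    (R : Set P.Event → Set (P.Event × Q.Event) → Set Q.Event → Prop) : Prop :=
  ∀ C f D, R C f D →
    (∀ C' ⊆ C, P.Config C' → ∃ D' ⊆ D, R C' {p ∈ f | p.1 ∈ C' ∧ p.2 ∈ D'} D') ∧
    (∀ D' ⊆ D, Q.Config D' → ∃ C' ⊆ C, R C' {p ∈ f | p.1 ∈ C' ∧ p.2 ∈ D'} D')

/-- Rooted branching history-preserving bisimulations whose residual triples lie in branching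
hp-bisimulations with the property `H`. -/
def RootedHPBisim (P : PES.{u, w} A) (Q : PES.{u, w'} A)
    (H : (Set P.Event → Set (P.Event × Q.Event) → Set Q.Event → Prop) → Prop)
    (R : Set P.Event → Set (P.Event × Q.Event) → Set Q.Event → Prop) : Prop :=
  ∀ C f D, R C f D → Posetal P Q C f D ∧
    (∀ a C', P.Tr C {a} C' →
      ∃ b D', Q.Tr D {b} D' ∧ P.label a = Q.label b ∧
        ∃ T, BranchingHP P Q T ∧ H T ∧ T C' (upd P Q f a b) D') ∧
    (∀ b D', Q.Tr D {b} D' →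
      ∃ a C', P.Tr C {a} C' ∧ P.label a = Q.label b ∧
        ∃ T, BranchingHP P Q T ∧ H T ∧ T C' (upd P Q f a b) D') ∧
    (P.done C ↔ Q.done D)

/-- Rooted branching hp-bisimilarity of prime event structures. -/
def RootedHP (P : PES.{u, w} A) (Q : PES.{u, w'} A) : Prop :=
  ∃ R, RootedHPBisim P Q (fun _ => True) R ∧ R ∅ ∅ ∅

/-- Rooted branching hhp-bisimilarity of prime event structures: there is a downward closed rooted
branching hp-bisimulation, whose residuals moreover lie in hereditary branching hp-bisimulations. -/
def RootedHHP (P : PES.{u, w} A) (Q : PES.{u, w'} A) : Prop :=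
  ∃ R, RootedHPBisim P Q (Hereditary P Q) R ∧ DownwardClosed P Q R ∧ R ∅ ∅ ∅

end PES

/-! ## The prime event structure of a term -/

/-- Runs of a term: sequences of consecutive transitions, given by their labels and results. -/
def IsRun {A : Type u} {V : Type v} (le : Act A → Act A → Prop) :
    Term A V → List (List (Act A) × Option (Term A V)) → Prop
  | _, [] => True
  | t, (L, none) :: p => Step le t L none ∧ p = []
  | t, (L, some t') :: p => Step le t L (some t') ∧ IsRun le t' p

/-- The occurrence of the `idx`-th action in the label of the last transition of a run. -/
structure Occ {A : Type u} {V : Type v} (le : Act A → Act A → Prop) (t : Term A V) where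
  hist : List (List (Act A) × Option (Term A V))
  last : List (Act A) × Option (Term A V)
  run : IsRun le t (hist ++ [last])
  idx : Fin last.1.length

namespace Occ

variable {A : Type u} {V : Type v} {le : Act A → Act A → Prop} {t : Term A V}

/-- The run at whose end an occurrence lies. -/
def path (e : Occ le t) : List (List (Act A) × Option (Term A V)) := e.hist ++ [e.last]

theorem hist_prefix (e : Occ le t) : e.hist <+: e.path := List.prefix_append _ _

/-- An occurrence causes all occurrences in later transitions. -/
def Le (e f : Occ le t) : Prop := e = f ∨ e.path <+: f.hist

theorem Le.path_prefix {e f : Occ le t} (h : e.Le f) : e.path <+: f.path := by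
  rcases h with rfl | h
  · exact List.prefix_rfl
  · exact h.trans f.hist_prefix

/-- Occurrences on diverging runs are in conflict. -/
def Conflict (e f : Occ le t) : Prop := ¬ e.path <+: f.path ∧ ¬ f.path <+: e.path

theorem finite_causes (e : Occ le t) : {f : Occ le t | f.Le e}.Finite := by
  have hinj : Set.InjOn (fun f : Occ le t => (f.path, f.idx.val)) {f : Occ le t | f.Le e} := by
    rintro ⟨h₁, l₁, r₁, i₁⟩ - ⟨h₂, l₂, r₂, i₂⟩ - h
    simp only [path, Prod.mk.injEq] at h
    obtain ⟨h, hi⟩ := h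
    obtain ⟨rfl, h⟩ := List.append_inj' h rfl
    obtain rfl : l₁ = l₂ := by simpa using h
    obtain rfl : i₁ = i₂ := Fin.ext hi
    rfl
  refine Set.Finite.of_finite_image ?_ hinj
  have hfin : {p : List (List (Act A) × Option (Term A V)) | p <+: e.path}.Finite := by
    refine (List.finite_toSet e.path.inits).subset ?_
    intro p hp
    simpa using hp
  refine (hfin.biUnion (t := fun p => (fun n : ℕ => (p, n)) ''
    Set.Iio ((p.getLast?.map fun s => s.1.length).getD 0)) fun p _ =>
      (Set.finite_Iio _).image _).subset ?_
  rintro _ ⟨f, hf, rfl⟩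
  simp only [Set.mem_iUnion]
  refine ⟨f.path, hf.path_prefix, f.idx.val, ?_, rfl⟩
  simp [path]

end Occ

/-- The prime event structure of a term, obtained by unfolding its transitions: the actions of one
transition are pairwise concurrent, those of later transitions are caused by those of earlier ones,
and different choices are in conflict. A configuration terminates if it is a complete run to `√`. -/
def Term.pes {A : Type u} {V : Type v} (le : Act A → Act A → Prop) (t : Term A V) :
    PES.{u, max u v} A where
  Event := Occ le t
  le := Occ.Le
  conflict := Occ.Conflict
  label e := e.last.1.get e.idx
  done C := ∃ p L, IsRun le t (p ++ [(L, none)]) ∧ C = {e : Occ le t | e.path <+: p ++ [(L, none)]}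
  le_refl _ := Or.inl rfl
  le_trans := by
    rintro e f g (rfl | h) (rfl | h')
    · exact Or.inl rfl
    · exact Or.inr h'
    · exact Or.inr h
    · exact Or.inr (h.trans (f.hist_prefix.trans h'))
  le_antisymm := by
    rintro e f (rfl | h) (h' | h')
    · rfl
    · rfl
    · exact h'.symm
    · have h₁ := h.length_le
      have h₂ := h'.length_le
      simp only [Occ.path, List.length_append, List.length_singleton] at h₁ h₂
      omega
  finite_causes := Occ.finite_causes
  conflict_irrefl _ h := h.1 List.prefix_rfl
  conflict_symm _ _ h := ⟨h.2, h.1⟩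
  conflict_hered := by
    intro e f g h hfg
    refine ⟨fun h' => ?_, fun h' => h.2 (hfg.path_prefix.trans h')⟩
    rcases List.prefix_or_prefix_of_prefix h' hfg.path_prefix with h'' | h''
    · exact h.1 h''
    · exact h.2 h''

/-- `≈_rbs` on terms. -/
def RBS {A : Type u} {V : Type v} (le : Act A → Act A → Prop) (s t : Term A V) : Prop :=
  PES.Rooted .step (s.pes le) (t.pes le)

/-- `≈_rbp` on terms. -/
def RBP {A : Type u} {V : Type v} (le : Act A → Act A → Prop) (s t : Term A V) : Prop :=
  PES.Rooted .pomset (s.pes le) (t.pes le)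

/-- `≈_rbhp` on terms. -/
def RBHP {A : Type u} {V : Type v} (le : Act A → Act A → Prop) (s t : Term A V) : Prop :=
  PES.RootedHP (s.pes le) (t.pes le)

/-- `≈_rbhhp` on terms. -/
def RBHHP {A : Type u} {V : Type v} (le : Act A → Act A → Prop) (s t : Term A V) : Prop :=
  PES.RootedHHP (s.pes le) (t.pes le)

end APTC

namespace APTC

universe u v w w'

/-! ### Growth of configurations. -/

namespace PES

variable {A : Type u}

/-! The hidden transitions between variables of the cluster become silent, and any variable of the
cluster reaches any other by them. So a run of `τ_I(⟨X|E⟩)` wanders silently through the cluster,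
possibly leaves it by an exit, and afterwards is literally a run of the sum of the exits. Let `G`
send an event of the left-hand side to the event obtained by deleting the initial wandering from its
run; wandering events go to the initial `τ` of the right-hand side. That initial `τ` is the reason
why the rooted equivalences hold: it is the least event on both sides and absorbs the deleted
events.

`G` is a `Contraction`: it keeps labels, it keeps and reflects causality between compatible visible
events, and configurations lift along it because every exit stays reachable during the wandering.
For any contraction, the pairs `(C, G '' C)`, together with the graph of `G` on visible events, form
the bisimulations for all four equivalences; going back is handled by images and preimages under
`G`.

The argument splits into `Contraction.rooted` and `Contraction.rootedHHP` (contractions yield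
equivalences), `exists_contraction_of_runs` (deleting initial silent transitions yields a
contraction) and `exists_contraction_of_isCluster` (wandering in a cluster can be so deleted). -/

theorem Config.tr_diff {P : PES.{u, w} A} {C C' : Set P.Event} (hC : P.Config C)
    (hC' : P.Config C') (h : C ⊆ C') (hne : (C' \ C).Nonempty) : P.Tr C (C' \ C) C' :=
  ⟨hC, hne, Set.disjoint_sdiff_right, by rw [Set.union_sdiff_cancel h], hC'⟩

theorem Tr.subset {P : PES.{u, w} A} {C X C' : Set P.Event} (h : P.Tr C X C') : C ⊆ C' := by
  rw [h.2.2.2.1]; exact Set.subset_union_left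

/-- Between nested configurations one can add a single event. -/
theorem Config.exists_insert {P : PES.{u, w} A} {C C' : Set P.Event} (hC : P.Config C)
    (hC' : P.Config C') (h : C ⊆ C') (hne : (C' \ C).Nonempty) :
    ∃ e ∈ C' \ C, P.Tr C {e} (C ∪ {e}) := by
  let _ : PartialOrder P.Event :=
    { le := P.le
      le_refl := P.le_refl
      le_trans := P.le_trans
      le_antisymm := P.le_antisymm }
  -- All proper causes of a minimal new event already lie in `C`.
  obtain ⟨e, he⟩ := (hC'.1.subset (Set.sdiff_subset (t := C))).exists_minimal hne
  have hmem : e ∈ C' \ C := he.1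
  have hsub : C ∪ {e} ⊆ C' := Set.union_subset h (Set.singleton_subset_iff.2 hmem.1)
  refine ⟨e, hmem, hC, Set.singleton_nonempty _, Set.disjoint_singleton_right.2 hmem.2, rfl,
    hC'.1.subset hsub, fun x hx y hy => hC'.2.1 x (hsub hx) y (hsub hy), ?_⟩
  rintro x (hx | rfl) f hf
  · exact Or.inl (hC.2.2 x hx f hf)
  · by_cases hfC : f ∈ C
    · exact Or.inl hfC
    · exact Or.inr (P.le_antisymm _ _ hf (he.2 ⟨hC'.2.2 _ hmem.1 f hf, hfC⟩ hf))

/-- A configuration silently evolves into any larger one with the same visible events. -/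
theorem Config.tauStar {P : PES.{u, w} A} {C C' : Set P.Event} (hC : P.Config C)
    (hC' : P.Config C') (h : C ⊆ C') (hs : ∀ e ∈ C' \ C, P.Silent e) : P.TauStar C C' := by
  obtain ⟨n, hn⟩ : ∃ n, (C' \ C).ncard = n := ⟨_, rfl⟩
  induction n generalizing C with
  | zero =>
    rw [Set.ncard_eq_zero (hC'.1.subset Set.sdiff_subset), Set.sdiff_eq_empty] at hn
    rw [h.antisymm hn]
    exact Relation.ReflTransGen.refl
  | succ n ih =>
    obtain ⟨e, he, htr⟩ := hC.exists_insert hC' h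
      (Set.nonempty_of_ncard_ne_zero (by omega))
    have hd : C' \ (C ∪ {e}) = (C' \ C) \ {e} := by rw [Set.sdiff_sdiff]
    refine Relation.ReflTransGen.head ⟨e, hs e he, htr⟩
      (ih htr.2.2.2.2 (Set.union_subset h (Set.singleton_subset_iff.2 he.1)) ?_ ?_)
    · exact fun f hf => hs f (by rw [hd] at hf; exact hf.1)
    · rw [hd, Set.ncard_sdiff_singleton_of_mem he]; omega

theorem config_empty (P : PES.{u, w} A) : P.Config ∅ :=
  ⟨Set.finite_empty, by simp, by simp⟩

/-- Maps of prime event structures with a silent least event which preserve everything but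
multiplicities of silent events, and along which configurations can be extended. -/
structure Contraction (P : PES.{u, w} A) (Q : PES.{u, w'} A) (G : P.Event → Q.Event)
    (root : P.Event) : Prop where
  label_map : ∀ e, Q.label (G e) = P.label e
  root_silent : P.Silent root
  root_le : ∀ e, P.le root e
  map_root_le : ∀ d, Q.le (G root) d
  map_le : ∀ e f, P.le e f → Q.le (G e) (G f)
  -- Conflicting events are exempt: runs that differ only in the forgotten part yield distinct,
  -- conflicting visible events with one common image.
  le_of_map_le : ∀ e f, ¬ P.Silent e → ¬ P.Silent f → ¬ P.conflict e f →
    Q.le (G e) (G f) → P.le e f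
  conflict_of_map : ∀ e f, Q.conflict (G e) (G f) → P.conflict e f
  exists_le_of_le_map : ∀ d e, Q.le d (G e) → ∃ e', P.le e' e ∧ G e' = d
  lift : ∀ C D, P.Config C → Q.Config D → G '' C ⊆ D →
    ∃ C', P.Config C' ∧ C ⊆ C' ∧ G '' C' = D
  done_iff : ∀ C, P.Config C → (P.done C ↔ Q.done (G '' C))

/-! ### The equivalences induced by a contraction. -/

namespace Contraction

variable {P : PES.{u, w} A} {Q : PES.{u, w'} A} {G : P.Event → Q.Event} {root : P.Event}
  (h : Contraction P Q G root)
include h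

theorem silent_map (e : P.Event) : Q.Silent (G e) ↔ P.Silent e := by
  rw [Silent, Silent, h.label_map]

theorem config_image {C : Set P.Event} (hC : P.Config C) : Q.Config (G '' C) := by
  refine ⟨hC.1.image _, ?_, ?_⟩
  · rintro _ ⟨e, he, rfl⟩ _ ⟨f, hf, rfl⟩ hc
    exact hC.2.1 e he f hf (h.conflict_of_map e f hc)
  · rintro _ ⟨e, he, rfl⟩ d hd
    obtain ⟨e', he', rfl⟩ := h.exists_le_of_le_map d e hd
    exact ⟨e', hC.2.2 e he e' he', rfl⟩

theorem config_preimage {C : Set P.Event} {D : Set Q.Event} (hC : P.Config C)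
    (hD : Q.Config D) : P.Config {e ∈ C | G e ∈ D} :=
  ⟨hC.1.subset (Set.sep_subset _ _), fun e he f hf => hC.2.1 e he.1 f hf.1,
    fun e he f hf => ⟨hC.2.2 e he.1 f hf, hD.2.2 _ he.2 _ (h.map_le f e hf)⟩⟩

theorem vis_image (X : Set P.Event) : Q.vis (G '' X) = G '' P.vis X := by
  ext d
  constructor
  · rintro ⟨⟨e, he, rfl⟩, hs⟩
    exact ⟨e, ⟨he, fun h' => hs ((h.silent_map e).2 h')⟩, rfl⟩
  · rintro ⟨e, he, rfl⟩
    exact ⟨⟨e, he.1, rfl⟩, fun h' => he.2 ((h.silent_map e).1 h')⟩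

theorem map_le_iff {C : Set P.Event} (hC : P.Config C) {e f : P.Event} (he : e ∈ P.vis C)
    (hf : f ∈ P.vis C) : Q.le (G e) (G f) ↔ P.le e f :=
  ⟨h.le_of_map_le e f he.2 hf.2 (hC.2.1 e he.1 f hf.1), h.map_le e f⟩

theorem injOn {C : Set P.Event} (hC : P.Config C) : Set.InjOn G (P.vis C) := by
  intro e he f hf hef
  refine P.le_antisymm _ _ ((h.map_le_iff hC he hf).1 ?_) ((h.map_le_iff hC hf he).1 ?_)
  · rw [hef]; exact Q.le_refl _
  · rw [hef]; exact Q.le_refl _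

/-- A visible `e` would share its image with a visible event of `C`, against injectivity on the
visible part of `C'`. -/
theorem silent_of_map_mem {C C' : Set P.Event} (hC' : P.Config C') (hsub : C ⊆ C') {e : P.Event}
    (he : e ∈ C') (heC : e ∉ C) (hG : G e ∈ G '' C) : P.Silent e := by
  by_contra hs
  obtain ⟨f, hf, hfe⟩ := hG
  have hfs : ¬ P.Silent f := by rwa [← h.silent_map, hfe, h.silent_map]
  exact heC (h.injOn hC' ⟨hsub hf, hfs⟩ ⟨he, hs⟩ hfe ▸ hf)

theorem pomIso_image {X : Set P.Event} (hinj : Set.InjOn G X)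
    (hle : ∀ e ∈ X, ∀ f ∈ X, Q.le (G e) (G f) → P.le e f) : PomIso P Q X (G '' X) :=
  ⟨Equiv.Set.imageOfInjOn G X hinj, fun e => (h.label_map e).symm,
    fun e f => ⟨h.map_le e f, hle e e.2 f f.2⟩⟩

theorem pomIso_vis {X C : Set P.Event} (hC : P.Config C) (hX : X ⊆ C) :
    PomIso P Q (P.vis X) (G '' P.vis X) := by
  have hsub : P.vis X ⊆ P.vis C := fun e he => ⟨hX he.1, he.2⟩
  exact h.pomIso_image ((h.injOn hC).mono hsub)
    fun e he f hf => (h.map_le_iff hC (hsub he) (hsub hf)).1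

theorem root_mem {C : Set P.Event} (hC : P.Config C) (hne : C.Nonempty) : root ∈ C := by
  obtain ⟨e, he⟩ := hne
  exact hC.2.2 e he root (h.root_le e)

theorem map_root_mem {D : Set Q.Event} (hD : Q.Config D) (hne : D.Nonempty) : G root ∈ D := by
  obtain ⟨e, he⟩ := hne
  exact hD.2.2 e he _ (h.map_root_le e)

theorem config_root : P.Config {root} := by
  refine ⟨Set.finite_singleton _, ?_, ?_⟩
  · rintro e rfl f rfl
    exact P.conflict_irrefl _
  · rintro e rfl f hf
    exact P.le_antisymm _ _ hf (h.root_le f)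

/-- The least event `root` lies in every nonempty configuration, so it is the only minimal event
there. -/
theorem rootVis_eq {C : Set P.Event} (hC : P.Config C) (hne : C.Nonempty) :
    P.rootVis C = insert root (P.vis C) := by
  ext e
  constructor
  · rintro ⟨he, hs | hm⟩
    · exact Or.inr ⟨he, hs⟩
    · exact Or.inl (hm root (h.root_mem hC hne) (h.root_le e)).symm
  · rintro (rfl | he)
    · exact ⟨h.root_mem hC hne, Or.inr fun f _ hf => P.le_antisymm _ _ hf (h.root_le f)⟩
    · exact ⟨he.1, Or.inl he.2⟩

theorem rootVis_image {C : Set P.Event} (hC : P.Config C) (hne : C.Nonempty) :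
    Q.rootVis (G '' C) = G '' P.rootVis C := by
  rw [h.rootVis_eq hC hne, Set.image_insert_eq, ← h.vis_image]
  ext e
  constructor
  · rintro ⟨he, hs | hm⟩
    · exact Or.inr ⟨he, hs⟩
    · exact Or.inl (hm _ ⟨root, h.root_mem hC hne, rfl⟩ (h.map_root_le e)).symm
  · rintro (rfl | he)
    · exact ⟨⟨root, h.root_mem hC hne, rfl⟩,
        Or.inr fun f _ hf => Q.le_antisymm _ _ hf (h.map_root_le f)⟩
    · exact ⟨he.1, Or.inl he.2⟩

theorem pomIso_rootVis {C : Set P.Event} (hC : P.Config C) (hne : C.Nonempty) :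
    PomIso P Q (P.rootVis C) (Q.rootVis (G '' C)) := by
  rw [h.rootVis_image hC hne]
  have key : ∀ e ∈ P.rootVis C, ∀ f ∈ P.rootVis C, Q.le (G e) (G f) → P.le e f := by
    rw [h.rootVis_eq hC hne]
    rintro e (rfl | he) f hf hle
    · exact h.root_le f
    · rcases hf with rfl | hf
      -- A visible `e` cannot map below the least event `G root`: it would then equal it, but `G
      -- root` is silent.
      · refine absurd ?_ he.2
        rw [← h.silent_map, Q.le_antisymm _ _ hle (h.map_root_le _), h.silent_map]
        exact h.root_silent
      · exact (h.map_le_iff hC he hf).1 hle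
  refine h.pomIso_image (fun e he f hf hef => P.le_antisymm _ _ ?_ ?_) key
  · exact key e he f hf (hef ▸ Q.le_refl _)
  · exact key f hf e he (hef ▸ Q.le_refl _)

theorem label_vis {k : Kind} {X C : Set P.Event} (hC : P.Config C) (hX : X ⊆ C)
    (hk : P.Label k X) : Q.Label k (G '' P.vis X) := by
  cases k with
  | pomset => trivial
  | step =>
    rintro _ ⟨e, he, rfl⟩ _ ⟨f, hf, rfl⟩ hne
    obtain ⟨h₁, h₂, h₃⟩ := hk e he.1 f hf.1 (fun h' => hne (h' ▸ rfl))
    exact ⟨fun h' => h₁ ((h.map_le_iff hC ⟨hX he.1, he.2⟩ ⟨hX hf.1, hf.2⟩).1 h'),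
      fun h' => h₂ ((h.map_le_iff hC ⟨hX hf.1, hf.2⟩ ⟨hX he.1, he.2⟩).1 h'),
      fun h' => h₃ (h.conflict_of_map e f h')⟩

theorem label_vis_of_image {k : Kind} {X : Set P.Event} {Y : Set Q.Event} {C : Set P.Event}
    (hC : P.Config C) (hX : X ⊆ C) (hXY : G '' X ⊆ Y)
    (hk : Q.Label k Y) : P.Label k (P.vis X) := by
  cases k with
  | pomset => trivial
  | step =>
    intro e he f hf hne
    have hne' : G e ≠ G f := fun h' =>
      hne (h.injOn hC ⟨hX he.1, he.2⟩ ⟨hX hf.1, hf.2⟩ h')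
    obtain ⟨h₁, h₂, h₃⟩ := hk _ (hXY ⟨e, he.1, rfl⟩) _ (hXY ⟨f, hf.1, rfl⟩) hne'
    exact ⟨fun h' => h₁ (h.map_le _ _ h'), fun h' => h₂ (h.map_le _ _ h'),
      hC.2.1 e (hX he.1) f (hX hf.1)⟩

/-- Transitions of the image are matched, after silent events which the map does not see. -/
theorem exists_tauStar_of_tr {C : Set P.Event} (hC : P.Config C) {X D' : Set Q.Event}
    (htr : Q.Tr (G '' C) X D') :
    ∃ C₀ C', P.TauStar C C₀ ∧ P.Config C₀ ∧ P.vis C₀ = P.vis C ∧ G '' C₀ = G '' C ∧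
      P.Tr C₀ (C' \ C₀) C' ∧ G '' C' = D' ∧ G '' (C' \ C₀) = X := by
  obtain ⟨hD, hX, hdisj, rfl, hD'⟩ := htr
  obtain ⟨C', hC', hsub, himg⟩ := h.lift C _ hC hD' Set.subset_union_left
  have hC₀ := h.config_preimage hC' hD
  have hsub₀ : C ⊆ {e ∈ C' | G e ∈ G '' C} := fun e he => ⟨hsub he, e, he, rfl⟩
  have himg₀ : G '' (C' \ {e ∈ C' | G e ∈ G '' C}) = X := by
    ext d
    constructor
    · rintro ⟨e, ⟨he, hn⟩, rfl⟩
      have : G e ∈ G '' C ∪ X := himg ▸ ⟨e, he, rfl⟩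
      exact this.resolve_left fun h' => hn ⟨he, h'⟩
    · intro hd
      obtain ⟨e, he, rfl⟩ : d ∈ G '' C' := himg ▸ Or.inr hd
      exact ⟨e, ⟨he, fun h' => Set.disjoint_left.1 hdisj h'.2 hd⟩, rfl⟩
  have hs : ∀ e ∈ {e ∈ C' | G e ∈ G '' C} \ C, P.Silent e :=
    fun e he => h.silent_of_map_mem hC' hsub he.1.1 he.2 he.1.2
  -- The middle configuration collects every event of the lift whose image is already present. It
  -- adds only silent events to `C`, and what remains of `C'` maps exactly onto `X`.
  refine ⟨{e ∈ C' | G e ∈ G '' C}, C', hC.tauStar hC₀ hsub₀ hs, hC₀, ?_, ?_, ?_, himg, himg₀⟩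
  · ext e
    refine ⟨fun he => ⟨?_, he.2⟩, fun he => ⟨hsub₀ he.1, he.2⟩⟩
    by_contra hn
    exact he.2 (hs e ⟨he.1, hn⟩)
  · refine Set.Subset.antisymm ?_ (Set.image_mono hsub₀)
    rintro _ ⟨e, he, rfl⟩
    exact he.2
  · exact hC₀.tr_diff hC' (Set.sep_subset _ _) (Set.image_nonempty.1 (himg₀ ▸ hX))

/-- If a move of `C` does not enlarge the image, it is silent and needs no answer; otherwise the
increment of the image answers it. Moves of the image are answered by lifting, after a silent
preparation that leaves the image unchanged. -/
theorem branchingBisim (k : Kind) :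
    BranchingBisim k P Q fun C D => P.Config C ∧ D = G '' C := by
  rintro C _ ⟨hC, rfl⟩
  refine ⟨hC, h.config_image hC, ?_, ?_, ?_, ?_⟩
  · intro X C' htr hk
    have hsub := htr.subset
    obtain ⟨-, hX, hdisj, hC'eq, hC'⟩ := htr
    have hXC' : X ⊆ C' := hC'eq ▸ Set.subset_union_right
    by_cases hne : (G '' C' \ G '' C).Nonempty
    · right
      have hvis : Q.vis (G '' C' \ G '' C) = G '' P.vis X := by
        ext d
        constructor
        · rintro ⟨⟨⟨e, he, rfl⟩, hn⟩, hs⟩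
          refine ⟨e, ⟨?_, fun h' => hs ((h.silent_map e).2 h')⟩, rfl⟩
          rw [hC'eq] at he
          exact he.resolve_left fun h' => hn ⟨e, h', rfl⟩
        · rintro ⟨e, he, rfl⟩
          refine ⟨⟨⟨e, hXC' he.1, rfl⟩, fun hG => he.2 ?_⟩, fun h' => he.2 ((h.silent_map e).1 h')⟩
          exact h.silent_of_map_mem hC' hsub (hXC' he.1)
            (Set.disjoint_right.1 hdisj he.1) hG
      refine ⟨G '' C, G '' C' \ G '' C, G '' C', Relation.ReflTransGen.refl, ⟨hC, rfl⟩,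
        (h.config_image hC).tr_diff (h.config_image hC') (Set.image_mono hsub) hne, ?_, ?_,
        hC', rfl⟩
      · rw [hvis]; exact h.label_vis hC' hXC' hk
      · rw [hvis]; exact h.pomIso_vis hC' hXC'
    · left
      rw [Set.not_nonempty_iff_eq_empty, Set.sdiff_eq_empty] at hne
      exact ⟨fun e he => h.silent_of_map_mem hC' hsub (hXC' he) (Set.disjoint_right.1 hdisj he)
        (hne ⟨e, hXC' he, rfl⟩), hC', (Set.image_mono hsub).antisymm hne⟩
  · intro X D' htr hk
    obtain ⟨C₀, C', hτ, hC₀, -, h₀, htr', rfl, himg⟩ := h.exists_tauStar_of_tr hC htr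
    have hC' := htr'.2.2.2.2
    refine Or.inr ⟨C₀, C' \ C₀, C', hτ, ⟨hC₀, h₀.symm⟩, htr', ?_, ?_, hC', rfl⟩
    · exact h.label_vis_of_image hC' Set.sdiff_subset himg.subset hk
    · rw [← himg, h.vis_image]
      exact h.pomIso_vis hC' Set.sdiff_subset
  · exact fun hd => ⟨_, Relation.ReflTransGen.refl, ⟨hC, rfl⟩, (h.done_iff C hC).1 hd⟩
  · exact fun hd => ⟨_, Relation.ReflTransGen.refl, ⟨hC, rfl⟩, (h.done_iff C hC).2 hd⟩

/-- Only `(∅, ∅)` has to be rooted. A first move is itself a configuration, hence contains the least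
event, and its observed part is that event plus the visible ones, on which `G` is an isomorphism. -/
theorem rooted (k : Kind) : Rooted k P Q := by
  have hbr : ∀ C, P.Config C → Branching k P Q C (G '' C) :=
    fun C hC => ⟨_, h.branchingBisim k, hC, rfl⟩
  refine ⟨fun C D => C = ∅ ∧ D = ∅, ?_, rfl, rfl⟩
  rintro _ _ ⟨rfl, rfl⟩
  refine ⟨P.config_empty, Q.config_empty, ?_, ?_, ?_⟩
  · rintro X C' ⟨-, hX, -, rfl, hC'⟩ hk
    rw [Set.empty_union] at hC' ⊢
    refine ⟨G '' X, G '' X, ⟨Q.config_empty, hX.image G, Set.empty_disjoint _,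
      (Set.empty_union _).symm, h.config_image hC'⟩, ?_, h.pomIso_rootVis hC' hX, hbr X hC'⟩
    cases k with
    | pomset => trivial
    | step =>
      have hroot : ∀ e ∈ X, root = e := fun e he => by
        by_contra hne
        exact (hk root (h.root_mem hC' hX) e he hne).1 (h.root_le e)
      rintro _ ⟨e, he, rfl⟩ _ ⟨f, hf, rfl⟩ hne
      exact absurd (by rw [← hroot e he, ← hroot f hf]) hne
  · rintro X D' ⟨-, hX, -, rfl, hD'⟩ hk
    rw [Set.empty_union] at hD' ⊢
    obtain ⟨C', hC', himg, hl⟩ : ∃ C', P.Config C' ∧ G '' C' = X ∧ P.Label k C' := by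
      cases k with
      | pomset =>
        obtain ⟨C', hC', -, himg⟩ := h.lift ∅ X P.config_empty hD' (by simp)
        exact ⟨C', hC', himg, trivial⟩
      | step =>
        -- A step from `∅` contains the least event `G root` and so nothing else. It must be
        -- answered by `{root}`: an arbitrary lift could contain further silent events, caused by
        -- `root`.
        refine ⟨{root}, h.config_root, ?_, ?_⟩
        · have hroot := h.map_root_mem hD' hX
          rw [Set.image_singleton, eq_comm, Set.eq_singleton_iff_unique_mem]
          refine ⟨hroot, fun e he => ?_⟩
          by_contra hne
          exact (hk e he _ hroot hne).2.1 (h.map_root_le e)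
        · rintro e rfl f rfl hne
          exact absurd rfl hne
    subst himg
    have hne := Set.image_nonempty.1 hX
    exact ⟨C', C', ⟨P.config_empty, hne, Set.empty_disjoint _, (Set.empty_union _).symm, hC'⟩,
      hl, h.pomIso_rootVis hC' hne, hbr C' hC'⟩
  · simpa using h.done_iff ∅ P.config_empty

/-- Transitions by a single event of the image are matched by a single event. -/
theorem exists_tauStar_of_tr_singleton {C : Set P.Event} (hC : P.Config C) {b : Q.Event}
    {D' : Set Q.Event} (htr : Q.Tr (G '' C) {b} D') :
    ∃ C₀ a C', P.TauStar C C₀ ∧ P.Config C₀ ∧ P.vis C₀ = P.vis C ∧ G '' C₀ = G '' C ∧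
      P.Tr C₀ {a} C' ∧ G '' C' = D' ∧ G a = b := by
  obtain ⟨C₀, C', hτ, hC₀, hvis, h₀, htr', -, himg⟩ := h.exists_tauStar_of_tr hC htr
  obtain ⟨a, ha, htr₁⟩ := hC₀.exists_insert htr'.2.2.2.2 htr'.subset htr'.2.1
  have hab : G a = b := by
    have : G a ∈ G '' (C' \ C₀) := ⟨a, ha, rfl⟩
    rwa [himg] at this
  refine ⟨C₀, a, _, hτ, hC₀, hvis, h₀, htr₁, ?_, hab⟩
  rw [Set.image_union, h₀, Set.image_singleton, hab, htr.2.2.2.1]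

omit h in
theorem upd_graph {C C' : Set P.Event} {a : P.Event} (hC' : C' = C ∪ {a})
    (ha : Q.Silent (G a) ↔ P.Silent a) :
    upd P Q {p | p.1 ∈ P.vis C ∧ p.2 = G p.1} a (G a) = {p | p.1 ∈ P.vis C' ∧ p.2 = G p.1} := by
  ext ⟨e, d⟩
  subst hC'
  simp only [upd, vis, ha, Set.mem_union, Set.mem_ofPred_eq, Set.mem_singleton_iff,
    Prod.mk.injEq]
  constructor
  · rintro (⟨⟨he, hs⟩, rfl⟩ | ⟨⟨rfl, rfl⟩, hs, -⟩)
    · exact ⟨⟨Or.inl he, hs⟩, rfl⟩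
    · exact ⟨⟨Or.inr rfl, hs⟩, rfl⟩
  · rintro ⟨⟨he | rfl, hs⟩, rfl⟩
    · exact Or.inl ⟨⟨he, hs⟩, rfl⟩
    · exact Or.inr ⟨⟨rfl, rfl⟩, hs, hs⟩

theorem posetal {C : Set P.Event} (hC : P.Config C) :
    Posetal P Q C {p | p.1 ∈ P.vis C ∧ p.2 = G p.1} (G '' C) := by
  refine ⟨hC, h.config_image hC, ?_, fun e he => ⟨G e, he, rfl⟩, ?_, ?_⟩
  · rintro ⟨e, d⟩ ⟨he, (rfl : d = G e)⟩
    rw [h.vis_image]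
    exact ⟨he, ⟨e, he, rfl⟩, (h.label_map e).symm⟩
  · rw [h.vis_image]
    rintro _ ⟨e, he, rfl⟩
    exact ⟨e, he, rfl⟩
  · rintro ⟨e, d⟩ ⟨he, (rfl : d = G e)⟩ ⟨f, d⟩ ⟨hf, (rfl : d = G f)⟩
    exact (h.map_le_iff hC he hf).symm

/-- The history isomorphism is forced to be the graph of `G` on visible events; silent preparation
does not change that graph. -/
theorem branchingHP : BranchingHP P Q fun C f D =>
    P.Config C ∧ f = {p | p.1 ∈ P.vis C ∧ p.2 = G p.1} ∧ D = G '' C := by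
  rintro C _ _ ⟨hC, rfl, rfl⟩
  refine ⟨h.posetal hC, ?_, ?_, ?_, ?_⟩
  · intro a C' htr
    have hsub := htr.subset
    obtain ⟨-, -, hdisj, hC'eq, hC'⟩ := htr
    have haC : a ∉ C := Set.disjoint_singleton_right.1 hdisj
    have haC' : a ∈ C' := hC'eq ▸ Or.inr rfl
    have himg : G '' C' = G '' C ∪ {G a} := by rw [hC'eq, Set.image_union, Set.image_singleton]
    by_cases hG : G a ∈ G '' C
    · have hs := h.silent_of_map_mem hC' hsub haC' haC hG
      refine Or.inl ⟨hs, hC', ?_, ?_⟩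
      · rw [← upd_graph hC'eq (h.silent_map a)]
        simp [upd, hs]
      · rw [himg, Set.union_eq_left.2 (Set.singleton_subset_iff.2 hG)]
    · refine Or.inr ⟨G '' C, G a, G '' C', Relation.ReflTransGen.refl, ⟨hC, rfl, rfl⟩,
        ⟨h.config_image hC, Set.singleton_nonempty _, Set.disjoint_singleton_right.2 hG, himg,
          h.config_image hC'⟩, (h.label_map a).symm, hC', ?_, rfl⟩
      exact upd_graph hC'eq (h.silent_map a)
  · intro b D' htr
    obtain ⟨C₀, a, C', hτ, hC₀, hvis, h₀, htr', rfl, rfl⟩ :=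
      h.exists_tauStar_of_tr_singleton hC htr
    refine Or.inr ⟨C₀, a, C', hτ, ⟨hC₀, by rw [hvis], h₀.symm⟩, htr', (h.label_map a).symm,
      htr'.2.2.2.2, ?_, rfl⟩
    rw [← hvis]
    exact upd_graph htr'.2.2.2.1 (h.silent_map a)
  · exact fun hd => ⟨_, Relation.ReflTransGen.refl, ⟨hC, rfl, rfl⟩, (h.done_iff C hC).1 hd⟩
  · exact fun hd => ⟨_, Relation.ReflTransGen.refl, ⟨hC, rfl, rfl⟩, (h.done_iff C hC).2 hd⟩

/-- Going back to `C'` is answered by `G '' C'`, and going back to `D'` by the part of `C` lying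
over `D'`, whose image is all of `D'`. -/
theorem hereditary : Hereditary P Q fun C f D =>
    P.Config C ∧ f = {p | p.1 ∈ P.vis C ∧ p.2 = G p.1} ∧ D = G '' C := by
  rintro C _ _ ⟨hC, rfl, rfl⟩
  have hgraph : ∀ C' ⊆ C, {p ∈ {p : P.Event × Q.Event | p.1 ∈ P.vis C ∧ p.2 = G p.1} |
      p.1 ∈ C' ∧ p.2 ∈ G '' C'} = {p | p.1 ∈ P.vis C' ∧ p.2 = G p.1} := by
    rintro C' hsub
    ext ⟨e, d⟩
    constructor
    · rintro ⟨⟨he, (rfl : d = G e)⟩, he', -⟩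
      exact ⟨⟨he', he.2⟩, rfl⟩
    · rintro ⟨he, (rfl : d = G e)⟩
      exact ⟨⟨⟨hsub he.1, he.2⟩, rfl⟩, he.1, e, he.1, rfl⟩
  constructor
  · intro C' hsub hC'
    exact ⟨G '' C', Set.image_mono hsub, hC', hgraph C' hsub, rfl⟩
  · intro D' hsub hD'
    have himg : G '' {e ∈ C | G e ∈ D'} = D' := by
      refine Set.Subset.antisymm ?_ ?_
      · rintro _ ⟨e, he, rfl⟩
        exact he.2
      · intro d hd
        obtain ⟨e, he, rfl⟩ := hsub hd
        exact ⟨e, ⟨he, hd⟩, rfl⟩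
    refine ⟨{e ∈ C | G e ∈ D'}, Set.sep_subset _ _, h.config_preimage hC hD', ?_, himg.symm⟩
    rw [← hgraph _ (Set.sep_subset _ _), himg]

theorem rootedHHP : RootedHHP P Q := by
  have hT : ∀ a C', P.Tr ∅ {a} C' →
      ∃ T, BranchingHP P Q T ∧ Hereditary P Q T ∧ T C' (upd P Q ∅ a (G a)) (G '' C') := by
    intro a C' htr
    refine ⟨_, h.branchingHP, h.hereditary, htr.2.2.2.2, ?_, rfl⟩
    rw [← upd_graph htr.2.2.2.1 (h.silent_map a)]
    simp [vis]
  have hposetal := h.posetal P.config_empty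
  simp only [vis, Set.mem_empty_iff_false, false_and, Set.ofPred_false, Set.image_empty]
    at hposetal
  refine ⟨fun C f D => C = ∅ ∧ f = ∅ ∧ D = ∅, ?_, ?_, rfl, rfl, rfl⟩
  · rintro _ _ _ ⟨rfl, rfl, rfl⟩
    refine ⟨hposetal, ?_, ?_, by simpa using h.done_iff ∅ P.config_empty⟩
    · intro a C' htr
      refine ⟨G a, G '' C', ⟨Q.config_empty, Set.singleton_nonempty _, Set.empty_disjoint _, ?_,
        h.config_image htr.2.2.2.2⟩, (h.label_map a).symm, hT a C' htr⟩
      rw [htr.2.2.2.1, Set.image_union, Set.image_empty, Set.image_singleton]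
    · intro b D' htr
      rw [← Set.image_empty G] at htr
      obtain ⟨C₀, a, C', -, -, -, h₀, htr', rfl, rfl⟩ :=
        h.exists_tauStar_of_tr_singleton P.config_empty htr
      -- The rooted clause allows no silent preparation, and none occurs: `C₀` has empty image.
      obtain rfl : C₀ = ∅ := by simpa using h₀
      exact ⟨a, C', htr', (h.label_map a).symm, hT a C' htr'⟩
  · rintro C f D _ _ _ - hC hf hD ⟨rfl, rfl, rfl⟩
    exact ⟨Set.subset_empty_iff.1 hC, Set.subset_empty_iff.1 hf, Set.subset_empty_iff.1 hD⟩

end Contraction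

theorem RootedHHP.rootedHP {P : PES.{u, w} A} {Q : PES.{u, w'} A} (h : RootedHHP P Q) :
    RootedHP P Q := by
  obtain ⟨R, hR, -, h₀⟩ := h
  refine ⟨R, fun C f D hCfD => ?_, h₀⟩
  obtain ⟨h₁, h₂, h₃, h₄⟩ := hR C f D hCfD
  refine ⟨h₁, fun a C' htr => ?_, fun b D' htr => ?_, h₄⟩
  · obtain ⟨b, D', htr', hl, T, hT, -, hTr⟩ := h₂ a C' htr
    exact ⟨b, D', htr', hl, T, hT, trivial, hTr⟩
  · obtain ⟨a, C', htr', hl, T, hT, -, hTr⟩ := h₃ b D' htr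
    exact ⟨a, C', htr', hl, T, hT, trivial, hTr⟩

end PES

/-! ### Deleting the longest initial segment that satisfies a predicate. -/

section Lists

variable {α : Type*} {M : α → Bool} {p q : List α}

theorem dropWhile_prefix_dropWhile (h : p <+: q) : p.dropWhile M <+: q.dropWhile M := by
  obtain ⟨r, rfl⟩ := h
  rw [List.dropWhile_append]
  split_ifs with h'
  · rw [List.isEmpty_iff.1 h']
    exact List.nil_prefix
  · exact List.prefix_append _ _

theorem eq_of_dropWhile_eq (h : p <+: q) (hne : p.dropWhile M ≠ [])
    (heq : p.dropWhile M = q.dropWhile M) : p = q := by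
  obtain ⟨r, rfl⟩ := h
  rw [List.dropWhile_append, if_neg (by simpa using hne)] at heq
  rw [List.self_eq_append_right.1 heq, List.append_nil]

/-- Restoring the deleted segment of `p` gives a preimage of `q` that lies on `p`; nothing more is
deleted, since a nonempty `q` starts with an entry failing `M`. -/
theorem dropWhile_takeWhile_append (h : q <+: p.dropWhile M) :
    (p.takeWhile M ++ q).dropWhile M = q := by
  rw [List.dropWhile_append_of_pos fun _ => List.mem_takeWhile_imp]
  cases q with
  | nil => rfl
  | cons l q =>
    obtain ⟨r, hr⟩ := h
    have := List.head_dropWhile_not M (l := p) (by simp [← hr])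
    simp only [← hr, List.cons_append, List.head_cons] at this
    simp [this]

theorem takeWhile_append_prefix (h : q <+: p.dropWhile M) : p.takeWhile M ++ q <+: p := by
  conv_rhs => rw [← List.takeWhile_append_dropWhile (p := M) (l := p)]
  exact (List.prefix_append_right_inj _).2 h

/-- Whatever survives keeps the last entry, so an occurrence in the last transition of a run still
makes sense on the shortened run. -/
theorem exists_dropWhile_concat {l : α} (h : (p ++ [l]).dropWhile M ≠ []) :
    ∃ q, (p ++ [l]).dropWhile M = q ++ [l] := by
  rw [List.dropWhile_append] at h ⊢
  split_ifs at h ⊢ with h'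
  · refine ⟨[], ?_⟩
    by_cases hl : M l = true
    · simp [hl] at h
    · simp [hl]
  · exact ⟨_, rfl⟩

end Lists

variable {A : Type u} {V : Type v} {le : Act A → Act A → Prop}

/-! ### Transitions and runs -/

theorem Step.label_ne_nil {t : Term A V} {L : List (Act A)} {r : Option (Term A V)}
    (h : Step le t L r) : L ≠ [] := by
  induction h with
  | lmerge a as h => simp
  | abs_done _ ih => simpa using ih
  | abs_step _ ih => simpa using ih
  | _ => assumption

theorem step_tau_seq {t : Term A V} {L : List (Act A)} {r : Option (Term A V)} :
    Step le (.seq .tau t) L r ↔ L = [.tau] ∧ r = some t := by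
  constructor
  · intro h
    cases h with
    | seq_done h => cases h; exact ⟨rfl, rfl⟩
    | seq_step h => cases h
  · rintro ⟨rfl, rfl⟩
    exact .seq_done (.lmerge .tau [] (List.pairwise_singleton _ _))

theorem step_abs {I : Set A} {t : Term A V} {L : List (Act A)} {r : Option (Term A V)} :
    Step le (.abs I t) L r ↔
      ∃ L' r', Step le t L' r' ∧ L = L'.map (hide I) ∧ r = r'.map (Term.abs I) := by
  constructor
  · intro h
    cases h with
    | abs_done h => exact ⟨_, _, h, rfl, rfl⟩
    | abs_step h => exact ⟨_, _, h, rfl, rfl⟩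
  · rintro ⟨L', _ | r', h, rfl, rfl⟩
    · exact .abs_done h
    · exact .abs_step h

theorem step_toTerm {E : Spec A V} {s : Summand A V} {L : List (Act A)}
    {r : Option (Term A V)} :
    Step le (s.toTerm E) L r ↔
      L = s.actions ∧ s.actions.Pairwise le ∧ r = s.target.map (Term.solution E) := by
  obtain ⟨a, as, _ | Y⟩ := s
  · constructor
    · intro h
      cases h with
      | lmerge _ _ h => exact ⟨rfl, h, rfl⟩
    · rintro ⟨rfl, h, rfl⟩
      exact .lmerge _ _ h
  · constructor
    · intro h
      cases h with
      | seq_done h => cases h with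
        | lmerge _ _ h => exact ⟨rfl, h, rfl⟩
      | seq_step h => cases h
    · rintro ⟨rfl, h, rfl⟩
      exact .seq_done (.lmerge _ _ h)

theorem step_sum {l : List (Term A V)} {L : List (Act A)} {r : Option (Term A V)} :
    Step le (.sum l) L r ↔ ∃ t ∈ l, Step le t L r := by
  induction l with
  | nil =>
    constructor
    · rintro ⟨⟩
    · simp
  | cons x l ih =>
    cases l with
    | nil => simp [Term.sum]
    | cons y l =>
      rw [List.exists_mem_cons_iff, ← ih]
      constructor
      · intro h
        cases h with
        | alt_left h => exact Or.inl h
        | alt_right h => exact Or.inr h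
      · rintro (h | h)
        · exact .alt_left h
        · exact .alt_right h

theorem step_sum_toTerm {E : Spec A V} {l : List (Summand A V)} {L : List (Act A)}
    {r : Option (Term A V)} :
    Step le (.sum (l.map (Summand.toTerm E))) L r ↔ ∃ s ∈ l, Step le (s.toTerm E) L r := by
  simp [step_sum]

theorem step_solution {E : Spec A V} {X : V} {L : List (Act A)} {r : Option (Term A V)} :
    Step le (.solution E X) L r ↔ ∃ s ∈ E X, Step le (s.toTerm E) L r := by
  rw [← step_sum_toTerm]
  constructor
  · intro h
    cases h with
    | solution h => exact h
  · exact .solution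

theorem hide_eq_tau {I : Set A} {a : Act A} : hide I a = .tau ↔ Hidden I a := by
  cases a with
  | tau => simp [hide, Hidden]
  | ev a => simp [hide, Hidden]

theorem IsRun.of_prefix {t : Term A V} {p q : List (List (Act A) × Option (Term A V))}
    (h : p <+: q) (hq : IsRun le t q) : IsRun le t p := by
  induction p generalizing t q with
  | nil => trivial
  | cons l p ih =>
    obtain ⟨r, rfl⟩ := h
    obtain ⟨L, _ | t'⟩ := l
    · obtain ⟨hs, hn⟩ := hq
      exact ⟨hs, (List.append_eq_nil_iff.1 hn).1⟩
    · exact ⟨hq.1, ih (List.prefix_append _ _) hq.2⟩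

theorem IsRun.eq_of_prefix {t : Term A V} {p q : List (List (Act A) × Option (Term A V))}
    {L : List (Act A)} (hq : IsRun le t q) (h : p ++ [(L, none)] <+: q) :
    q = p ++ [(L, none)] := by
  induction p generalizing t q with
  | nil =>
    obtain ⟨r, rfl⟩ := h
    simpa using hq.2
  | cons l p ih =>
    obtain ⟨r, rfl⟩ := h
    obtain ⟨L, _ | t'⟩ := l
    · simpa using hq.2
    · exact congrArg _ (ih hq.2 (List.prefix_append _ _))

theorem IsRun.label_ne_nil {t : Term A V} {p : List (List (Act A) × Option (Term A V))}
    {l : List (Act A) × Option (Term A V)} (h : IsRun le t (p ++ [l])) : l.1 ≠ [] := by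
  induction p generalizing t with
  | nil =>
    obtain ⟨L, _ | t'⟩ := l
    · exact h.1.label_ne_nil
    · exact h.1.label_ne_nil
  | cons k p ih =>
    obtain ⟨L, _ | t'⟩ := k
    · exact absurd h.2 (by simp)
    · exact ih h.2

theorem isRun_tau_seq {t : Term A V} {p : List (List (Act A) × Option (Term A V))} :
    IsRun le (.seq .tau t) p ↔ p = [] ∨ ∃ q, p = ([.tau], some t) :: q ∧ IsRun le t q := by
  rcases p with _ | ⟨⟨L, _ | t'⟩, p⟩
  · simp [IsRun]
  · simp [IsRun, step_tau_seq]
  · simp only [IsRun, step_tau_seq]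
    constructor
    · rintro ⟨⟨rfl, h⟩, hr⟩
      cases h
      exact Or.inr ⟨p, rfl, hr⟩
    · rintro (h | ⟨q, h, hq⟩)
      · cases h
      · cases h
        exact ⟨⟨rfl, rfl⟩, hq⟩

/-! ### Occurrences in terms of the form `τ · t` -/

namespace Occ

theorem ext_path {t : Term A V} {e f : Occ le t} (h : e.path = f.path)
    (hi : e.idx.val = f.idx.val) : e = f := by
  obtain ⟨h₁, l₁, r₁, i₁⟩ := e
  obtain ⟨h₂, l₂, r₂, i₂⟩ := f
  obtain ⟨rfl, h⟩ := List.append_inj' h rfl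
  obtain rfl : l₁ = l₂ := by simpa using h
  obtain rfl : i₁ = i₂ := Fin.ext hi
  rfl

/-- Occurrences in one transition have equal paths, so a prefix relation gives causality only when
it is proper. -/
theorem le_iff {t : Term A V} {e f : Occ le t} :
    e.Le f ↔ e = f ∨ e.path <+: f.path ∧ e.path ≠ f.path := by
  refine or_congr_right ⟨fun h => ⟨h.trans f.hist_prefix, fun heq => ?_⟩, ?_⟩
  · have := (heq ▸ h).length_le
    simp [path] at this
  · rintro ⟨h, hne⟩
    rw [show f.path = f.hist ++ [f.last] from rfl, List.prefix_concat_iff] at h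
    exact h.resolve_left hne

theorem finite_path_prefix {t : Term A V} (p : List (List (Act A) × Option (Term A V))) :
    {e : Occ le t | e.path <+: p}.Finite := by
  have hinj : Set.InjOn (fun f : Occ le t => (f.path, f.idx.val)) {e : Occ le t | e.path <+: p} :=
    fun e _ f _ h => ext_path (congrArg Prod.fst h) (congrArg Prod.snd h)
  refine Set.Finite.of_finite_image ?_ hinj
  refine (((List.finite_toSet p.inits).biUnion (t := fun q => (fun n : ℕ => (q, n)) ''
    Set.Iio ((q.getLast?.map fun s => s.1.length).getD 0)) fun q _ =>
      (Set.finite_Iio _).image _)).subset ?_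
  rintro _ ⟨f, hf, rfl⟩
  simp only [Set.mem_iUnion]
  refine ⟨f.path, by simpa using hf, f.idx.val, ?_, rfl⟩
  simp [path]

variable {t : Term A V}

/-- The run of `t` at whose end an occurrence in `τ · t` lies; it is empty for the initial `τ`. -/
def rest (e : Occ le (.seq .tau t)) : List (List (Act A) × Option (Term A V)) := e.path.tail

theorem path_eq (e : Occ le (.seq .tau t)) : e.path = ([.tau], some t) :: e.rest := by
  obtain h | ⟨q, h, -⟩ := isRun_tau_seq.1 e.run
  · simp at h
  · rw [rest, show e.path = _ from h, List.tail_cons]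

theorem isRun_rest (e : Occ le (.seq .tau t)) : IsRun le t e.rest := by
  obtain h | ⟨q, h, hq⟩ := isRun_tau_seq.1 e.run
  · simp at h
  · rwa [rest, show e.path = _ from h, List.tail_cons]

theorem path_prefix_iff {e f : Occ le (.seq .tau t)} : e.path <+: f.path ↔ e.rest <+: f.rest := by
  rw [path_eq, path_eq, List.cons_prefix_cons]
  simp

theorem rest_cases (e : Occ le (.seq .tau t)) :
    (e.rest = [] ∧ e.idx.val = 0 ∧ e.last.1.get e.idx = .tau) ∨
      ∃ q, e.rest = q ++ [e.last] := by
  have h := e.path_eq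
  obtain ⟨_ | ⟨k, h₁⟩, l, r, i⟩ := e
  · left
    simp only [path, List.nil_append, List.cons.injEq] at h
    obtain ⟨rfl, h⟩ := h
    obtain rfl : i = 0 := Subsingleton.elim (α := Fin 1) _ _
    exact ⟨rfl, rfl, rfl⟩
  · exact Or.inr ⟨h₁, rfl⟩

/-- The label of the initial `τ` has one position only, so the index matters only when `rest` is
nonempty. -/
theorem ext_rest {e f : Occ le (.seq .tau t)} (h : e.rest = f.rest)
    (hi : e.rest ≠ [] → e.idx.val = f.idx.val) : e = f := by
  refine ext_path (by rw [path_eq, path_eq, h]) ?_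
  by_cases hr : e.rest = []
  · rcases e.rest_cases with he | ⟨q, he⟩
    · rcases f.rest_cases with hf | ⟨q, hf⟩
      · rw [he.2.1, hf.2.1]
      · rw [← h, hr] at hf
        simp at hf
    · rw [hr] at he
      simp at he
  · exact hi hr

theorem le_iff_rest {e f : Occ le (.seq .tau t)} :
    e.Le f ↔ e = f ∨ e.rest <+: f.rest ∧ e.rest ≠ f.rest := by
  rw [le_iff, path_prefix_iff, path_eq, path_eq]
  simp

theorem conflict_iff {e f : Occ le (.seq .tau t)} :
    e.Conflict f ↔ ¬ e.rest <+: f.rest ∧ ¬ f.rest <+: e.rest := by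
  rw [Conflict, path_prefix_iff, path_prefix_iff]

theorem exists_rest_nil (le : Act A → Act A → Prop) (t : Term A V) :
    ∃ e : Occ le (.seq .tau t), e.rest = [] :=
  ⟨⟨[], ([.tau], some t), isRun_tau_seq.2 (Or.inr ⟨[], rfl, trivial⟩), ⟨0, Nat.zero_lt_one⟩⟩, rfl⟩

theorem exists_rest_concat {q : List (List (Act A) × Option (Term A V))}
    {l : List (Act A) × Option (Term A V)} (h : IsRun le t (q ++ [l])) (i : Fin l.1.length) :
    ∃ e : Occ le (.seq .tau t), e.rest = q ++ [l] ∧ e.last = l ∧ e.idx.val = i.val :=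
  ⟨⟨([.tau], some t) :: q, l, isRun_tau_seq.2 (Or.inr ⟨q ++ [l], rfl, h⟩), i⟩, rfl, rfl, rfl⟩

theorem exists_rest {q : List (List (Act A) × Option (Term A V))} (h : IsRun le t q) :
    ∃ e : Occ le (.seq .tau t), e.rest = q := by
  rcases List.eq_nil_or_concat q with rfl | ⟨q, l, rfl⟩
  · exact exists_rest_nil le t
  · rw [List.concat_eq_append] at h ⊢
    obtain ⟨e, he, -⟩ := exists_rest_concat h ⟨0, List.length_pos_iff.2 h.label_ne_nil⟩
    exact ⟨e, he⟩

theorem get_congr {s t : Term A V} {e : Occ le s} {f : Occ le t} (h : e.last = f.last)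
    (hi : e.idx.val = f.idx.val) : e.last.1.get e.idx = f.last.1.get f.idx := by
  simp only [List.get_eq_getElem]
  congr 1
  rw [h]

theorem finite_rest_prefix (p : List (List (Act A) × Option (Term A V))) :
    {e : Occ le (.seq .tau t) | e.rest <+: p}.Finite := by
  refine (finite_path_prefix (([.tau], some t) :: p)).subset fun e he => ?_
  rw [Set.mem_ofPred_eq, path_eq, List.cons_prefix_cons]
  exact ⟨rfl, he⟩

theorem done_iff {D : Set (Occ le (.seq .tau t))} :
    ((Term.seq .tau t).pes le).done D ↔
      ∃ p L, IsRun le t (p ++ [(L, none)]) ∧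
        D = {e : Occ le (.seq .tau t) | e.rest <+: p ++ [(L, none)]} := by
  have hpre : ∀ (p) (e : Occ le (.seq .tau t)),
      e.path <+: ([.tau], some t) :: p ↔ e.rest <+: p := by
    intro p e
    rw [path_eq, List.cons_prefix_cons]
    simp
  constructor
  · rintro ⟨p, L, hr, hD⟩
    obtain h | ⟨q, h, hq⟩ := isRun_tau_seq.1 hr
    · simp at h
    · rcases p with _ | ⟨k, p⟩
      · simp at h
      · rw [List.cons_append, List.cons.injEq] at h
        obtain ⟨rfl, rfl⟩ := h
        refine ⟨p, L, hq, hD.trans ?_⟩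
        ext e
        exact hpre _ e
  · rintro ⟨p, L, hr, rfl⟩
    refine ⟨([.tau], some t) :: p, L, isRun_tau_seq.2 (Or.inr ⟨_, rfl, hr⟩), ?_⟩
    ext e
    exact (hpre _ e).symm

/-- Without conflict the runs of the events form a chain under prefix, and the longest one bounds
all. -/
theorem exists_maximal_rest {C : Set (Occ le (.seq .tau t))}
    (hC : ((Term.seq .tau t).pes le).Config C) (hne : C.Nonempty) :
    ∃ e ∈ C, ∀ f ∈ C, f.rest <+: e.rest := by
  obtain ⟨e, he, hmax⟩ := hC.1.exists_maximalFor (fun e => e.rest.length) C hne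
  refine ⟨e, he, fun f hf => ?_⟩
  have hcf : ¬ e.Conflict f := hC.2.1 e he f hf
  rw [conflict_iff, not_and_or, not_not, not_not] at hcf
  rcases hcf with h | h
  · rw [h.eq_of_length (le_antisymm h.length_le (hmax hf h.length_le))]
  · exact h

end Occ

/-! ### From forgetting initial transitions to a contraction. -/

open PES

/-- If `t` can be obtained from `s` by forgetting the initial silent transitions which satisfy `M`,
then there is a contraction from `τ · s` to `τ · t`. -/
theorem exists_contraction_of_runs {s t : Term A V}
    (M : List (Act A) × Option (Term A V) → Bool)
    (hM : ∀ l, M l → (∀ a ∈ l.1, a = .tau) ∧ l.2 ≠ none)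
    (hdrop : ∀ p, IsRun le s p → IsRun le t (p.dropWhile M))
    (hext : ∀ p q, IsRun le s p → IsRun le t q → p.dropWhile M <+: q →
      ∃ p', p <+: p' ∧ IsRun le s p' ∧ p'.dropWhile M = q) :
    ∃ G root, Contraction ((Term.seq .tau s).pes le) ((Term.seq .tau t).pes le) G root := by
  -- If part of the run survives, the image is the same occurrence at the end of the shortened run;
  -- if nothing survives, it is the initial `τ`.
  have hG : ∀ e : Occ le (.seq .tau s), ∃ d : Occ le (.seq .tau t),
      d.rest = e.rest.dropWhile M ∧ (d.rest ≠ [] → d.last = e.last ∧ d.idx.val = e.idx.val) := by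
    intro e
    by_cases hd : e.rest.dropWhile M = []
    · obtain ⟨d, hd'⟩ := Occ.exists_rest_nil le t
      exact ⟨d, hd'.trans hd.symm, fun h => absurd hd' h⟩
    · rcases e.rest_cases with he | ⟨q, he⟩
      · rw [he.1] at hd
        exact absurd rfl hd
      · obtain ⟨q', hq'⟩ := exists_dropWhile_concat (he ▸ hd)
        have hrun := hdrop _ e.isRun_rest
        rw [he, hq'] at hrun
        obtain ⟨d, h₁, h₂, h₃⟩ := Occ.exists_rest_concat hrun e.idx
        exact ⟨d, by rw [he, hq', h₁], fun _ => ⟨h₂, h₃⟩⟩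
  choose G hrest hlast using hG
  obtain ⟨root, hroot⟩ := Occ.exists_rest_nil le s
  have hGroot : (G root).rest = [] := by rw [hrest, hroot]; rfl
  have hnil : ∀ (t : Term A V) (e : Occ le (.seq .tau t)), e.rest = [] →
      e.last.1.get e.idx = .tau := by
    intro t e he
    rcases e.rest_cases with h | ⟨q, h⟩
    · exact h.2.2
    · simp [he] at h
  have hlabel : ∀ e, (G e).last.1.get (G e).idx = e.last.1.get e.idx := by
    intro e
    by_cases hd : (G e).rest = []
    · rw [hnil t _ hd]
      rcases e.rest_cases with he | ⟨q, he⟩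
      · exact he.2.2.symm
      · rw [hrest, he, List.dropWhile_eq_nil_iff] at hd
        exact ((hM _ (hd e.last (by simp))).1 _ (List.get_mem _ _)).symm
    · exact Occ.get_congr (hlast e hd).1 (hlast e hd).2
  have heq : ∀ e f, e.rest = f.rest → G e = G f → (G e).rest ≠ [] → e = f := by
    intro e f h hG hd
    refine Occ.ext_rest h fun _ => ?_
    rw [← (hlast e hd).2, hG, (hlast f (hG ▸ hd)).2]
  have hvis : ∀ e : Occ le (.seq .tau s), e.last.1.get e.idx ≠ .tau → (G e).rest ≠ [] :=
    fun e he hd => he (by rw [← hlabel, hnil t _ hd])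
  -- occurrences below the image of a run have preimages on that run
  have hlift : ∀ (d : Occ le (.seq .tau t)) (p), IsRun le s p → d.rest <+: p.dropWhile M →
      ∃ e : Occ le (.seq .tau s), e.rest <+: p ∧ G e = d := by
    intro d p hp hd
    by_cases hd' : d.rest = []
    · refine ⟨root, by rw [hroot]; exact List.nil_prefix, ?_⟩
      exact Occ.ext_rest (hGroot.trans hd'.symm) fun h => absurd hGroot h
    · rcases d.rest_cases with h | ⟨q, hq⟩
      · exact absurd h.1 hd'
      · have hpre := takeWhile_append_prefix hd
        have hrun := hp.of_prefix hpre
        rw [hq, ← List.append_assoc] at hrun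
        obtain ⟨e, h₁, -, h₂⟩ := Occ.exists_rest_concat hrun d.idx
        rw [List.append_assoc, ← hq] at h₁
        refine ⟨e, h₁ ▸ hpre, ?_⟩
        have hr : (G e).rest = d.rest := by rw [hrest, h₁, dropWhile_takeWhile_append hd]
        exact Occ.ext_rest hr fun h => (hlast e h).2.trans h₂
  have hmap_le : ∀ e f : Occ le (.seq .tau s), e.Le f → (G e).Le (G f) := by
    intro e f h
    rw [Occ.le_iff_rest] at h ⊢
    rcases h with rfl | ⟨h, hne⟩
    · exact Or.inl rfl
    · by_cases hd : (G e).rest = (G f).rest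
      · left
        refine Occ.ext_rest hd fun hn => ?_
        rw [hrest] at hn
        rw [hrest, hrest] at hd
        exact absurd (eq_of_dropWhile_eq h hn hd) hne
      · right
        refine ⟨?_, hd⟩
        rw [hrest, hrest]
        exact dropWhile_prefix_dropWhile h
  have hdown : ∀ (d : Occ le (.seq .tau t)) (e : Occ le (.seq .tau s)), d.Le (G e) →
      ∃ e' : Occ le (.seq .tau s), e'.Le e ∧ G e' = d := by
    intro d e h
    rw [Occ.le_iff_rest] at h
    rcases h with rfl | ⟨h, hne⟩
    · exact ⟨e, Or.inl rfl, rfl⟩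
    · obtain ⟨e', he', rfl⟩ := hlift d e.rest e.isRun_rest (hrest e ▸ h)
      refine ⟨e', Occ.le_iff_rest.2 (Or.inr ⟨he', fun h' => hne ?_⟩), rfl⟩
      rw [hrest, hrest, h']
  refine ⟨G, root, hlabel, hnil s root hroot, ?_, ?_, hmap_le, ?_, ?_, hdown, ?_, ?_⟩
  · intro e
    refine Occ.le_iff_rest.2 ?_
    by_cases he : e.rest = []
    · exact Or.inl (Occ.ext_rest (hroot.trans he.symm) fun h => absurd hroot h)
    · exact Or.inr ⟨hroot ▸ List.nil_prefix, fun h => he (h.symm.trans hroot)⟩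
  · intro d
    refine Occ.le_iff_rest.2 ?_
    by_cases hd : d.rest = []
    · exact Or.inl (Occ.ext_rest (hGroot.trans hd.symm) fun h => absurd hGroot h)
    · exact Or.inr ⟨hGroot ▸ List.nil_prefix, fun h => hd (h.symm.trans hGroot)⟩
  · intro (e : Occ le (.seq .tau s)) (f : Occ le (.seq .tau s)) he hf hc hle
    have hde := hvis e he
    have hdf := hvis f hf
    replace hc : ¬ e.Conflict f := hc
    replace hle : (G e).Le (G f) := hle
    rw [Occ.le_iff_rest] at hle
    change e.Le f
    have same : e.rest = f.rest → e.Le f := by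
      intro h
      refine Or.inl (heq e f h ?_ hde)
      exact hle.resolve_right fun h' => h'.2 (by rw [hrest, hrest, h])
    rw [Occ.conflict_iff, not_and_or, not_not, not_not] at hc
    rcases hc with h | h
    · by_cases hne : e.rest = f.rest
      · exact same hne
      · exact Occ.le_iff_rest.2 (Or.inr ⟨h, hne⟩)
    -- If the run of `f` is a prefix of that of `e`, causality between the images gives the converse
    -- prefix after deletion; the shortened runs then agree, hence so do the runs.
    · refine same (eq_of_dropWhile_eq h (hrest f ▸ hdf) ?_).symm
      have h₁ := dropWhile_prefix_dropWhile (M := M) h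
      have h₂ : (G e).rest <+: (G f).rest := by
        rcases hle with h' | h'
        · rw [h']
        · exact h'.1
      rw [hrest, hrest] at h₂
      exact h₁.eq_of_length (le_antisymm h₁.length_le h₂.length_le)
  · intro (e : Occ le (.seq .tau s)) (f : Occ le (.seq .tau s)) h
    replace h : (G e).Conflict (G f) := h
    change e.Conflict f
    rw [Occ.conflict_iff, hrest, hrest] at h
    exact Occ.conflict_iff.2 ⟨fun h' => h.1 (dropWhile_prefix_dropWhile h'),
      fun h' => h.2 (dropWhile_prefix_dropWhile h')⟩
  · intro (C : Set (Occ le (.seq .tau s))) (D : Set (Occ le (.seq .tau t))) hC hD hsub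
    rcases D.eq_empty_or_nonempty with rfl | hne
    · exact ⟨C, hC, subset_rfl, Set.subset_empty_iff.1 hsub⟩
    · obtain ⟨d, hd, hdmax⟩ := Occ.exists_maximal_rest hD hne
      obtain ⟨p, hp, hpC, hpd⟩ : ∃ p, IsRun le s p ∧ (∀ e ∈ C, Occ.rest e <+: p) ∧
          p.dropWhile M <+: d.rest := by
        rcases C.eq_empty_or_nonempty with rfl | hne'
        · exact ⟨[], trivial, by simp, List.nil_prefix⟩
        · obtain ⟨e, he, hemax⟩ := Occ.exists_maximal_rest hC hne'
          exact ⟨e.rest, e.isRun_rest, hemax, hrest e ▸ hdmax _ (hsub ⟨e, he, rfl⟩)⟩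
      obtain ⟨p', hpp', hp', hq⟩ := hext p d.rest hp d.isRun_rest hpd
      -- The restriction `G e ∈ D` is needed because `D` may contain only some occurrences of the
      -- last transition on its longest run.
      refine ⟨{e | Occ.rest e <+: p' ∧ G e ∈ D}, ⟨?_, ?_, ?_⟩, ?_, ?_⟩
      · exact (Occ.finite_rest_prefix p').subset fun e he => he.1
      · rintro e ⟨he, -⟩ f ⟨hf, -⟩ hc
        obtain ⟨h₁, h₂⟩ := Occ.conflict_iff.1 hc
        exact (List.prefix_or_prefix_of_prefix he hf).elim h₁ h₂
      · rintro e ⟨he, heD⟩ f hf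
        refine ⟨?_, hD.2.2 _ heD _ (hmap_le f e hf)⟩
        exact (Occ.path_prefix_iff.1 (Occ.Le.path_prefix hf)).trans he
      · exact fun e he => ⟨(hpC e he).trans hpp', hsub ⟨e, he, rfl⟩⟩
      · refine Set.Subset.antisymm ?_ fun f hf => ?_
        · rintro _ ⟨e, he, rfl⟩
          exact he.2
        · obtain ⟨e, he, rfl⟩ := hlift f p' hp' (hq ▸ hdmax f hf)
          exact ⟨e, ⟨he, hf⟩, rfl⟩
  · intro (C : Set (Occ le (.seq .tau s))) hC
    refine Occ.done_iff.trans (Iff.trans ?_ Occ.done_iff.symm)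
    constructor
    · rintro ⟨p, L, hr, rfl⟩
      have hd : ∃ q, (p ++ [(L, none)]).dropWhile M = q ++ [(L, none)] := by
        refine exists_dropWhile_concat fun h => ?_
        rw [List.dropWhile_eq_nil_iff] at h
        exact (hM _ (h (L, none) (by simp))).2 rfl
      obtain ⟨q, hq⟩ := hd
      have hpre : ∀ e : Occ le (.seq .tau s), e.rest <+: p ++ [(L, none)] →
          (G e).rest <+: q ++ [(L, none)] := fun e he => by
        rw [hrest, ← hq]
        exact dropWhile_prefix_dropWhile he
      refine ⟨q, L, hq ▸ hdrop _ hr, Set.Subset.antisymm ?_ fun f hf => ?_⟩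
      · rintro _ ⟨e, he, rfl⟩
        exact hpre e he
      · obtain ⟨e, he, rfl⟩ := hlift f _ hr (hq ▸ hf)
        exact ⟨e, he, rfl⟩
    · rintro ⟨q, L, hr, hD⟩
      have hmem : ∀ d : Occ le (.seq .tau t),
          (∃ e ∈ C, G e = d) ↔ d.rest <+: q ++ [(L, none)] := Set.ext_iff.1 hD
      -- An `e ∈ C` over an occurrence in the terminating transition determines the run: its path
      -- also ends in `√`, so compatibility puts all of `C` on it.
      obtain ⟨d, hd⟩ := Occ.exists_rest hr
      obtain ⟨e, he, hed⟩ := (hmem d).2 (by rw [hd])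
      have hdne : (G e).rest ≠ [] := by rw [hed, hd]; simp
      obtain ⟨p, hp⟩ : ∃ p, e.rest = p ++ [(L, none)] := by
        rcases e.rest_cases with h | ⟨p, h⟩
        · exact absurd (by rw [hrest, h.1]; rfl) hdne
        · have h₁ := hrest e
          obtain ⟨q', hq'⟩ := exists_dropWhile_concat (h ▸ (hrest e ▸ hdne))
          rw [hed, hd, h, hq'] at h₁
          exact ⟨p, by rw [h, ← (List.append_inj' h₁ rfl).2]⟩
      refine ⟨p, L, hp ▸ e.isRun_rest, Set.Subset.antisymm (fun f hf => ?_) fun f hf => ?_⟩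
      · have hc : ¬ e.Conflict f := hC.2.1 e he f hf
        rw [Occ.conflict_iff, not_and_or, not_not, not_not] at hc
        rw [Set.mem_ofPred_eq, ← hp]
        rcases hc with h | h
        · rw [hp] at h ⊢
          rw [f.isRun_rest.eq_of_prefix h]
        · exact h
      · rw [Set.mem_ofPred_eq, ← hp] at hf
        -- Events in earlier transitions are causes of `e`. For `f` in the final transition, the `g
        -- ∈ C` over `G f` is compatible with `e`, so it lies in that same transition, and its index
        -- makes it `f`.
        by_cases hfe : f.rest = e.rest
        · obtain ⟨g, hg, hgf⟩ := (hmem (G f)).2 (by rw [hrest, hfe, ← hrest, hed, hd])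
          have hfne : (G f).rest ≠ [] := by rwa [hrest, hfe, ← hrest]
          have hgr : g.rest = e.rest := by
            have h₁ : e.rest.dropWhile M = g.rest.dropWhile M := by
              rw [← hrest, ← hrest, hgf, hrest, hrest, hfe]
            have hc : ¬ e.Conflict g := hC.2.1 e he g hg
            rw [Occ.conflict_iff, not_and_or, not_not, not_not] at hc
            rcases hc with h | h
            · exact (eq_of_dropWhile_eq h (hrest e ▸ hdne) h₁).symm
            · exact eq_of_dropWhile_eq h (h₁ ▸ hrest e ▸ hdne) h₁.symm
          rw [← heq g f (hgr.trans hfe.symm) hgf (hgf ▸ hfne)]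
          exact hg
        · exact hC.2.2 e he f (Occ.le_iff_rest.2 (Or.inr ⟨hf, hfe⟩))

/-! ### Clusters -/

/-- Runs inside a cluster can be prepended to all runs of their target. -/
theorem IsCluster.exists_run {E : Spec A V} {I : Set A} {C : Set V} (hC : IsCluster le E I C)
    {W : V} (hW : W ∈ C) {t : Term A V}
    (h : Relation.ReflTransGen (HiddenStep le I) t (.solution E W)) :
    ∀ Z ∈ C, t = .solution E Z →
      ∃ p : List (List (Act A) × Option (Term A V)),
        (∀ l ∈ p, (∀ a ∈ l.1, a = .tau) ∧ ∃ Y ∈ C, l.2 = some (.abs I (.solution E Y))) ∧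
        ∀ q, IsRun le (.abs I (.solution E W)) q → IsRun le (.abs I (.solution E Z)) (p ++ q) := by
  induction h using Relation.ReflTransGen.head_induction_on with
  | refl =>
    intro Z _ h
    cases h
    exact ⟨[], by simp, fun q hq => hq⟩
  | head hs htail ih =>
    rintro Z hZ rfl
    obtain ⟨L, hL, hstep⟩ := id hs
    obtain ⟨s, -, hs'⟩ := step_solution.1 hstep
    obtain ⟨-, -, htgt⟩ := step_toTerm.1 hs'
    obtain ⟨Y, -, rfl⟩ := Option.map_eq_some_iff.1 htgt.symm
    -- The path through `Y` comes from `Z` and continues to `W`, both in the cluster, so it never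
    -- leaves the cluster.
    have hY : Y ∈ C := by
      obtain ⟨X, rfl⟩ := hC
      exact ⟨hZ.1.tail hs, htail.trans hW.2⟩
    obtain ⟨p, hp, hrun⟩ := ih Y hY rfl
    refine ⟨(L.map (hide I), some (.abs I (.solution E Y))) :: p, ?_,
      fun q hq => ⟨.abs_step hstep, hrun q hq⟩⟩
    rintro l (_ | ⟨_, hl⟩)
    · refine ⟨fun a ha => ?_, Y, hY, rfl⟩
      obtain ⟨b, hb, rfl⟩ := List.mem_map.1 ha
      exact hide_eq_tau.2 (hL b hb)
    · exact hp l hl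

theorem IsCluster.reflTransGen {E : Spec A V} {I : Set A} {C : Set V} (hC : IsCluster le E I C)
    {Z W : V} (hZ : Z ∈ C) (hW : W ∈ C) :
    Relation.ReflTransGen (HiddenStep le I) (.solution E Z) (.solution E W) := by
  obtain ⟨X, rfl⟩ := hC
  exact hZ.2.trans hW.1

/-- From a variable of the cluster, a transition is either internal and stays in the cluster, or is
a transition of the sum of exits with the same residual. Conversely, each exit becomes available
after finitely many internal transitions. -/
theorem exists_contraction_of_isCluster {E : Spec A V} {I : Set A} {C : Set V}
    (hC : IsCluster le E I C) {X : V} (hX : X ∈ C) {exits : List (Summand A V)}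
    (hexits : ∀ s, s ∈ exits ↔ IsExit E I C s) :
    ∃ G root, Contraction ((Term.seq .tau (.abs I (.solution E X))).pes le)
      ((Term.seq .tau (.abs I (.sum (exits.map (Summand.toTerm E))))).pes le) G root := by
  classical
  -- Internal transitions are recognised from the renamed label and the residual alone: an exit
  -- keeps a visible action or has its target outside `C`, so it never satisfies `M`.
  obtain ⟨M, hM⟩ : ∃ M : List (Act A) × Option (Term A V) → Bool, ∀ l, M l = true ↔
      (∀ a ∈ l.1, a = .tau) ∧ ∃ Y ∈ C, l.2 = some (.abs I (.solution E Y)) :=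
    ⟨fun l => decide _, fun l => decide_eq_true_iff⟩
  have hexit : ∀ Z ∈ C, ∀ L r, Step le (.abs I (.solution E Z)) L r → ¬ M (L, r) →
      Step le (.abs I (.sum (exits.map (Summand.toTerm E)))) L r := by
    intro Z hZ L r h hint
    obtain ⟨L, r, h', rfl, rfl⟩ := step_abs.1 h
    obtain ⟨s, hs, hstep⟩ := step_solution.1 h'
    refine step_abs.2 ⟨L, r, step_sum_toTerm.2 ⟨s, ?_, hstep⟩, rfl, rfl⟩
    obtain ⟨rfl, -, rfl⟩ := step_toTerm.1 hstep
    refine (hexits s).2 ⟨⟨Z, hZ, hs⟩, fun Y hY => ?_⟩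
    by_contra! hcon
    refine hint ((hM _).2 ⟨fun a ha => ?_, Y, hcon.2, by simp [hY]⟩)
    obtain ⟨b, hb, rfl⟩ := List.mem_map.1 ha
    exact hide_eq_tau.2 (hcon.1 b hb)
  have hexit' : ∀ L r, Step le (.abs I (.sum (exits.map (Summand.toTerm E)))) L r →
      ¬ M (L, r) ∧ ∃ W ∈ C, Step le (.abs I (.solution E W)) L r := by
    intro L r h
    obtain ⟨L, r, h', rfl, rfl⟩ := step_abs.1 h
    obtain ⟨s, hs, hstep⟩ := step_sum_toTerm.1 h'
    obtain ⟨⟨W, hW, hsW⟩, hs⟩ := (hexits s).1 hs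
    refine ⟨?_, W, hW, step_abs.2 ⟨L, r, step_solution.2 ⟨s, hsW, hstep⟩, rfl, rfl⟩⟩
    obtain ⟨rfl, -, rfl⟩ := step_toTerm.1 hstep
    intro hint
    obtain ⟨htau, Y, hY, htgt⟩ := (hM _).1 hint
    have htgt' : s.target = some Y := by
      revert htgt
      cases s.target <;> simp
    rcases hs Y htgt' with ⟨a, ha, hna⟩ | hn
    · exact hna (hide_eq_tau.1 (htau _ (List.mem_map_of_mem ha)))
    · exact hn hY
  refine exists_contraction_of_runs M ?_ ?_ ?_
  · intro l hl
    obtain ⟨h, Y, -, hY⟩ := (hM l).1 hl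
    exact ⟨h, by simp [hY]⟩
  · intro p
    induction p generalizing X with
    | nil => exact fun _ => trivial
    | cons l p ih =>
      intro hp
      by_cases hl : M l = true
      · rw [List.dropWhile_cons_of_pos hl]
        obtain ⟨L, _⟩ := l
        obtain ⟨-, Y, hY, rfl⟩ := (hM _).1 hl
        exact ih hY hp.2
      · rw [List.dropWhile_cons_of_neg hl]
        obtain ⟨L, _ | t'⟩ := l
        · exact ⟨hexit X hX _ _ hp.1 hl, hp.2⟩
        · exact ⟨hexit X hX _ _ hp.1 hl, hp.2⟩
  · intro p q
    induction p generalizing X with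
    | nil =>
      intro _ hq _
      rcases q with _ | ⟨⟨L, r⟩, q⟩
      · exact ⟨[], List.nil_prefix, trivial, rfl⟩
      · have hstep : Step le (.abs I (.sum (exits.map (Summand.toTerm E)))) L r := by
          cases r <;> exact hq.1
        obtain ⟨hint, W, hW, hstepW⟩ := hexit' L r hstep
        -- The exit may belong to another variable `W`; an internal run `c` from `X` to `W` makes it
        -- available and is deleted again.
        obtain ⟨c, hc, hrun⟩ := hC.exists_run hW (hC.reflTransGen hX hW) X hX rfl
        refine ⟨c ++ (L, r) :: q, List.nil_prefix, hrun _ ?_, ?_⟩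
        · cases r <;> exact ⟨hstepW, hq.2⟩
        · rw [List.dropWhile_append_of_pos fun l hl => (hM l).2 (hc l hl),
            List.dropWhile_cons_of_neg hint]
    | cons l p ih =>
      intro hp hq hpre
      by_cases hl : M l = true
      · rw [List.dropWhile_cons_of_pos hl] at hpre
        obtain ⟨L, _⟩ := l
        obtain ⟨-, Y, hY, rfl⟩ := (hM _).1 hl
        obtain ⟨p', hpp', hp', rfl⟩ := ih hY hp.2 hq hpre
        refine ⟨_ :: p', List.cons_prefix_cons.2 ⟨rfl, hpp'⟩, ⟨hp.1, hp'⟩, ?_⟩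
        rw [List.dropWhile_cons_of_pos hl]
      · rw [List.dropWhile_cons_of_neg hl] at hpre
        -- Here `p` has already left by an exit, so nothing is deleted from it and `q` itself is a
        -- run of the left-hand side extending it.
        refine ⟨q, hpre, ?_, ?_⟩
        · obtain ⟨r, rfl⟩ := hpre
          obtain ⟨L, _ | t'⟩ := l
          · exact ⟨hp.1, hq.2⟩
          · exact ⟨hp.1, hq.2⟩
        · obtain ⟨r, rfl⟩ := hpre
          rw [List.cons_append, List.dropWhile_cons_of_neg hl]

end APTC

theorem mainTheorem9 {A : Type*} {V : Type*} [Finite V]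
    (le : APTC.Act A → APTC.Act A → Prop)
    (E : APTC.Spec A V) (hE : E.Guarded le) (I : Set A)
    (C : Set V) (hC : APTC.IsCluster le E I C) (X : V) (hX : X ∈ C)
    (exits : List (APTC.Summand A V)) (hexits : ∀ s, s ∈ exits ↔ APTC.IsExit E I C s) :
    let lhs := APTC.Term.seq .tau (.abs I (.solution E X))
    let rhs := APTC.Term.seq .tau (.abs I (.sum (exits.map (APTC.Summand.toTerm E))))
    APTC.RBS le lhs rhs ∧ APTC.RBP le lhs rhs ∧ APTC.RBHP le lhs rhs ∧ APTC.RBHHP le lhs rhs := by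
  obtain ⟨G, root, h⟩ := APTC.exists_contraction_of_isCluster hC hX hexits
  exact ⟨h.rooted .step, h.rooted .pomset, h.rootedHHP.rootedHP, h.rootedHHP⟩
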